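/- Let $R\in\mathbb Z$ with $|R|>1$, let $B\subset\mathbb Z$ be a finite set with $0\in B$ and $N=|B|$ elements, put $\tau_b(x)=R^{-1}(x+b)$ for $b\in B$, $x\in\mathbb R$, and let $\mu_B$ be the invariant measure of $(\tau_b)_{b\in B}$, i.e. the unique Borel probability measure on $\mathbb R$ with $\int f\,d\mu_B=\frac1N\sum_{b\in B}\int f\circ\tau_b\,d\mu_B$ for all bounded Borel functions $f$. Let $m\ge1$, let $l_0,\dots,l_{m-1}\in\mathbb Z$ with $l_0=0$ and $\alpha_0,\dots,\alpha_{m-1}\in\mathbb C$ with $\alpha_0=1$, and assume that the matrix $$\frac1{\sqrt N}\left(e^{2\pi i R^{-1}b\,l_i}\alpha_i\right)_{0\le i\le m-1,\ b\in B}$$ is an isometry (it has orthonormal columns). For $t\in\mathbb R$ let $e_t(x)=e^{2\pi itx}$, $m_B(t)=\frac1N\sum_{b\in B}e^{2\pi ibt}$, $g_i(t)=R^{-1}(t-l_i)$ and $\nu_i(t)=\overline{\alpha_i}\,m_B(g_i(t))$. For a finite word $\omega=\omega_1\cdots\omega_n$ with digits in $\{0,\dots,m-1\}$ (the empty word is allowed)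 let $g_\omega=g_{\omega_n}\circ\cdots\circ g_{\omega_1}$ and $\nu_\omega(t)=\nu_{\omega_1}(t)\,\nu_{\omega_2}(g_{\omega_1}(t))\cdots\nu_{\omega_n}(g_{\omega_1\cdots\omega_{n-1}}(t))$. A set $S\subseteq\mathbb R$ is invariant if $g_i(t)\in S$ whenever $t\in S$ and $\nu_i(t)\neq0$; a minimal finite invariant set is a finite nonempty invariant set that has no nonempty proper invariant subset. A nonempty word $\beta=\beta_1\cdots\beta_p$ is a cycle word for $c$ if $g_\beta(c)=c$, $\nu_\beta(c)\ne0$, and $g_{\beta_1\cdots\beta_k}(c)\neq c$ for $1\le k<p$. Let $\Omega_c^{(0)}$ be the set of all finite words that do not end in a cycle word for $c$. Then there are only finitely many minimal finite invariant sets $M_1,\dots,M_p$, and for any choice of points $c_i\in M_i$, $i=1,\dots,p$, the family of weighted exponential functions $$\alpha_{\omega_1}\cdots\alpha_{\omega_n}\,e_{l_{\omega_1}+Rl_{\omega_2}+\cdots+R^{n-1}l_{\omega_n}+R^nc_i},\qquad \omega=\omega_1\cdots\omega_n\in\Omega_{c_i}^{(0)},\ i=1,\dots,p,$$ indexed by the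 pairs $(i,\omega)$, is a Parseval frame for $L^2(\mu_B)$: for every $v\in L^2(\mu_B)$, $\|v\|^2$ is the sum of the squared moduli of the inner products of $v$ with the members of the family. -/

import Mathlib

open MeasureTheory

namespace WeightedFourier

noncomputable section

/-! ### Parseval frames -/

/-- A family `(f i)` is a Parseval frame if `‖v‖² = ∑ |⟨v, f i⟩|²` for all `v`, with convergence
of the (nonnegative) series as part of the claim. -/
def IsParsevalFrame {ι H : Type*} [NormedAddCommGroup H] [InnerProductSpace ℂ H]
    (f : ι → H) : Prop :=
  ∀ v : H, HasSum (fun i => ‖inner ℂ (f i) v‖ ^ 2) (‖v‖ ^ 2)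

/-! ### The affine iterated function system and its invariant measure -/

/-- The contraction `τ_b(x) = R⁻¹ (x + b)`. -/
def tau (R b : ℤ) (x : ℝ) : ℝ := (R : ℝ)⁻¹ * (x + b)

/-- The probability measure `μ` is the invariant measure of `(τ_b)_{b ∈ B}`:
`∫ f dμ = (1/N) ∑_b ∫ f ∘ τ_b dμ` for all bounded Borel functions `f`, where `N = |B|`. -/
def IsInvariantMeasure (R : ℤ) (B : Finset ℤ) (μ : Measure ℝ) [IsProbabilityMeasure μ] : Prop :=
  ∀ f : ℝ → ℂ, Measurable f → (∃ C : ℝ, ∀ x, ‖f x‖ ≤ C) →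
    ∫ x, f x ∂μ = (1 / (B.card : ℂ)) * ∑ b ∈ B, ∫ x, f (tau R b x) ∂μ

/-! ### Exponential functions in `L²(μ)` -/

/-- `e_t(x) = e^{2πitx}`. -/
def expFun (t x : ℝ) : ℂ := Complex.exp (2 * Real.pi * Complex.I * (t * x))

theorem memLp_expFun (μ : Measure ℝ) [IsFiniteMeasure μ] (t : ℝ) : MemLp (expFun t) 2 μ := by
  have hc : Continuous (expFun t) := by unfold expFun; fun_prop
  refine MemLp.of_bound hc.aestronglyMeasurable 1 (Filter.Eventually.of_forall fun x => ?_)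
  have h : expFun t x = Complex.exp (((2 * Real.pi * (t * x) : ℝ) : ℂ) * Complex.I) := by
    unfold expFun; push_cast; ring_nf
  rw [h, Complex.norm_exp_ofReal_mul_I]

/-- The class of `e_t` in `L²(μ)`. -/
def expLp (μ : Measure ℝ) [IsFiniteMeasure μ] (t : ℝ) : Lp ℂ 2 μ :=
  (memLp_expFun μ t).toLp (expFun t)

/-! ### The random walk -/

/-- The matrix `N^{-1/2} (e^{2πi R⁻¹ b l_i} α_i)_{i, b}`. -/
def weightedMatrix (R : ℤ) (B : Finset ℤ) {m : ℕ} (l : Fin m → ℤ) (α : Fin m → ℂ) :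
    Matrix (Fin m) B ℂ :=
  fun i b => ((1 / Real.sqrt B.card : ℝ) : ℂ) *
    (Complex.exp (2 * Real.pi * Complex.I * ((R : ℂ)⁻¹ * (b : ℤ) * l i)) * α i)

/-- `m_B(t) = (1/N) ∑_{b ∈ B} e^{2πibt}`. -/
def mB (B : Finset ℤ) (t : ℝ) : ℂ :=
  (1 / (B.card : ℂ)) * ∑ b ∈ B, Complex.exp (2 * Real.pi * Complex.I * (b * t))

/-- `g_i(t) = R⁻¹ (t - l_i)`. -/
def g (R : ℤ) {m : ℕ} (l : Fin m → ℤ) (i : Fin m) (t : ℝ) : ℝ := (R : ℝ)⁻¹ * (t - l i)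

/-- `ν_i(t) = conj(α_i) m_B(g_i(t))`. -/
def nu (R : ℤ) (B : Finset ℤ) {m : ℕ} (l : Fin m → ℤ) (α : Fin m → ℂ) (i : Fin m) (t : ℝ) : ℂ :=
  (starRingEnd ℂ) (α i) * mB B (g R l i t)

/-- `g_ω = g_{ω_n} ∘ ⋯ ∘ g_{ω_1}` for a word `ω = ω_1 ⋯ ω_n`. -/
def gWord (R : ℤ) {m : ℕ} (l : Fin m → ℤ) : List (Fin m) → ℝ → ℝ
  | [], t => t
  | i :: ω, t => gWord R l ω (g R l i t)

/-- `ν_ω(t) = ν_{ω_1}(t) ν_{ω_2}(g_{ω_1}(t)) ⋯ ν_{ω_n}(g_{ω_{n-1}} ⋯ g_{ω_1}(t))`. -/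
def nuWord (R : ℤ) (B : Finset ℤ) {m : ℕ} (l : Fin m → ℤ) (α : Fin m → ℂ) :
    List (Fin m) → ℝ → ℂ
  | [], _ => 1
  | i :: ω, t => nu R B l α i t * nuWord R B l α ω (g R l i t)

/-- `S` is invariant: it contains `g_i(t)` for every `t ∈ S` and every `i` with `ν_i(t) ≠ 0`. -/
def IsInvariantSet (R : ℤ) (B : Finset ℤ) {m : ℕ} (l : Fin m → ℤ) (α : Fin m → ℂ)
    (S : Set ℝ) : Prop :=
  ∀ t ∈ S, ∀ i, nu R B l α i t ≠ 0 → g R l i t ∈ S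

/-- `S` is a finite set that is minimal among the nonempty invariant sets. -/
def IsMinimalFiniteInvariantSet (R : ℤ) (B : Finset ℤ) {m : ℕ} (l : Fin m → ℤ) (α : Fin m → ℂ)
    (S : Set ℝ) : Prop :=
  S.Finite ∧ Minimal (fun T : Set ℝ => T.Nonempty ∧ IsInvariantSet R B l α T) S

/-- `β` is a cycle word for `c`: nonempty, of nonzero weight, and it leads from `c` back to `c`
for the first time. -/
def IsCycleWord (R : ℤ) (B : Finset ℤ) {m : ℕ} (l : Fin m → ℤ) (α : Fin m → ℂ)
    (c : ℝ) (β : List (Fin m)) : Prop :=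
  β ≠ [] ∧ gWord R l β c = c ∧
    (∀ k, 0 < k → k < β.length → gWord R l (β.take k) c ≠ c) ∧ nuWord R B l α β c ≠ 0

/-- `Ω_c^{(0)}`: the finite words that do not end in a cycle word for `c`. -/
def Omega0 (R : ℤ) (B : Finset ℤ) {m : ℕ} (l : Fin m → ℤ) (α : Fin m → ℂ) (c : ℝ) :
    Set (List (Fin m)) :=
  {ω | ¬ ∃ β, IsCycleWord R B l α c β ∧ β <:+ ω}

/-- `l_{ω_1} + R l_{ω_2} + ⋯ + R^{n-1} l_{ω_n} + R^n c` for a word `ω = ω_1 ⋯ ω_n`. -/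
def wordFreq (R : ℤ) {m : ℕ} (l : Fin m → ℤ) (ω : List (Fin m)) (c : ℝ) : ℝ :=
  ∑ k : Fin ω.length, (R : ℝ) ^ (k : ℕ) * l (ω.get k) + (R : ℝ) ^ ω.length * c

/-- `α_{ω_1} ⋯ α_{ω_n} e_{l_{ω_1} + R l_{ω_2} + ⋯ + R^{n-1} l_{ω_n} + R^n c}` in `L²(μ)`. -/
def weightedExp (μ : Measure ℝ) [IsFiniteMeasure μ] (R : ℤ) {m : ℕ} (l : Fin m → ℤ)
    (α : Fin m → ℂ) (ω : List (Fin m)) (c : ℝ) : Lp ℂ 2 μ :=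
  (ω.map α).prod • expLp μ (wordFreq R l ω c)

end

/-! ### Existence of the invariant measure -/

section Existence

/-- The uniform distribution on `B`. -/
noncomputable def unif (B : Finset ℤ) : Measure B := ProbabilityTheory.uniformOn Set.univ

/-- Prepend a digit to a sequence of digits. -/
def cons {B : Finset ℤ} (p : B × (ℕ → B)) : ℕ → B
  | 0 => p.1
  | n + 1 => p.2 n

theorem measurable_cons {B : Finset ℤ} : Measurable (cons (B := B)) := by
  refine measurable_pi_iff.2 fun n => ?_
  cases n with
  | zero => exact measurable_fst
  | succ n => exact (measurable_pi_apply n).comp measurable_snd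

theorem map_cons {B : Finset ℤ} [IsProbabilityMeasure (unif B)] :
    ((unif B).prod (Measure.infinitePi fun _ : ℕ => unif B)).map cons =
      Measure.infinitePi fun _ : ℕ => unif B := by
  classical
  refine Measure.eq_infinitePi _ fun s t ht => ?_
  have hm : MeasurableSet ((s : Set ℕ).pi t) :=
    MeasurableSet.pi s.countable_toSet fun i _ => ht i
  rw [Measure.map_apply measurable_cons hm]
  set t' : ℕ → Set B := fun n => if n ∈ s then t n else Set.univ with ht'
  obtain ⟨n, hn⟩ : ∃ n, s ⊆ Finset.range (n + 1) :=
    ⟨s.sup id, fun i hi => Finset.mem_range.2 (Nat.lt_succ_of_le (Finset.le_sup (f := id) hi))⟩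
  have hpre : cons ⁻¹' ((s : Set ℕ).pi t) =
      t' 0 ×ˢ ((Finset.range n : Set ℕ).pi fun k => t' (k + 1)) := by
    ext ⟨b, x⟩
    simp only [Set.mem_preimage, Set.mem_pi, Finset.mem_coe, Set.mem_prod, ht', Finset.mem_range]
    constructor
    · intro h
      refine ⟨?_, fun k _ => ?_⟩
      · split_ifs with h0
        · exact h 0 h0
        · trivial
      · split_ifs with h0
        · exact h (k + 1) h0
        · trivial
    · rintro ⟨h0, h1⟩ i hi
      cases i with
      | zero => simpa [hi, cons] using h0
      | succ k =>
        have := h1 k (by have := Finset.mem_range.1 (hn hi); omega)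
        simpa [hi, cons] using this
  have hmt' : ∀ i, MeasurableSet (t' i) := fun i => by
    simp only [ht']; split_ifs
    · exact ht i
    · exact MeasurableSet.univ
  rw [hpre, Measure.prod_prod, Measure.infinitePi_pi _ (fun i _ => hmt' (i + 1))]
  calc unif B (t' 0) * ∏ k ∈ Finset.range n, unif B (t' (k + 1))
      = ∏ k ∈ Finset.range (n + 1), unif B (t' k) := by
        rw [Finset.prod_range_succ', mul_comm]
    _ = ∏ k ∈ s, unif B (t' k) := by
        refine (Finset.prod_subset hn fun i _ hi => ?_).symm
        simp [ht', hi]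
    _ = ∏ k ∈ s, unif B (t k) := Finset.prod_congr rfl fun i hi => by simp [ht', hi]

/-- The invariant measure exists, as the law of `∑_{k ≥ 1} R^{-k} b_k` for independent digits `b_k`
that are uniformly distributed on `B`. -/
theorem exists_isInvariantMeasure (R : ℤ) (hR : 1 < |R|) (B : Finset ℤ) (hB : B.Nonempty) :
    ∃ (μ : Measure ℝ) (_ : IsProbabilityMeasure μ), IsInvariantMeasure R B μ := by
  classical
  have : Nonempty B := hB.to_subtype
  have : IsProbabilityMeasure (unif B) :=
    ProbabilityTheory.instIsProbabilityMeasure_uniformOn_univ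
  set P : Measure (ℕ → B) := Measure.infinitePi fun _ : ℕ => unif B with hP
  have hR' : (1 : ℝ) < |(R : ℝ)| := by exact_mod_cast hR
  have hr : ‖(R : ℝ)⁻¹‖ < 1 := by
    rw [norm_inv, Real.norm_eq_abs]; exact inv_lt_one_of_one_lt₀ hR'
  obtain ⟨C, hC⟩ : ∃ C : ℝ, ∀ b : B, ‖((b : ℤ) : ℝ)‖ ≤ C := by
    obtain ⟨C, hC⟩ := (Set.finite_range fun b : B => ‖((b : ℤ) : ℝ)‖).bddAbove
    exact ⟨C, fun b => hC ⟨b, rfl⟩⟩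
  have hsum : ∀ x : ℕ → B, Summable fun k => (R : ℝ)⁻¹ ^ (k + 1) * ((x k : ℤ) : ℝ) := by
    intro x
    have hg : Summable fun k : ℕ => ‖(R : ℝ)⁻¹‖ ^ (k + 1) * C :=
      ((summable_nat_add_iff 1).2 (summable_geometric_of_lt_one (norm_nonneg _) hr)).mul_right C
    refine Summable.of_norm_bounded hg fun k => ?_
    rw [norm_mul, norm_pow]
    exact mul_le_mul_of_nonneg_left (hC _) (by positivity)
  set X : (ℕ → B) → ℝ := fun x => ∑' k, (R : ℝ)⁻¹ ^ (k + 1) * ((x k : ℤ) : ℝ) with hX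
  have hXm : Measurable X := by
    refine measurable_of_tendsto_metrizable (f := fun n x =>
      ∑ k ∈ Finset.range n, (R : ℝ)⁻¹ ^ (k + 1) * ((x k : ℤ) : ℝ)) (fun n => ?_) ?_
    · refine Finset.measurable_sum _ fun k _ => ?_
      have : Measurable fun b : B => ((b : ℤ) : ℝ) := measurable_of_finite _
      exact (this.comp (measurable_pi_apply k)).const_mul _
    · exact tendsto_pi_nhds.2 fun x => (hsum x).hasSum.tendsto_sum_nat
  have hcons : ∀ (b : B) (x : ℕ → B), X (cons (b, x)) = tau R b (X x) := by
    intro b x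
    simp only [hX, tau]
    rw [(hsum (cons (b, x))).tsum_eq_zero_add, add_comm ((∑' k, _ : ℝ)), mul_add, ← tsum_mul_left]
    simp only [cons, zero_add, pow_one]
    congr 1
    exact tsum_congr fun k => by ring
  refine ⟨P.map X, Measure.isProbabilityMeasure_map hXm.aemeasurable, fun f hf ⟨D, hD⟩ => ?_⟩
  have hτ : ∀ b : ℤ, Measurable (tau R b) := fun b => by unfold tau; fun_prop
  rw [integral_map hXm.aemeasurable hf.aestronglyMeasurable]
  have h1 : ∫ x, f (X x) ∂P = ∫ p, f (X (cons p)) ∂((unif B).prod P) := by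
    rw [← integral_map measurable_cons.aemeasurable (f := fun x => f (X x))
      (hf.comp hXm).aestronglyMeasurable, map_cons]
  have hint : Integrable (fun p => f (X (cons p))) ((unif B).prod P) :=
    Integrable.of_bound (hf.comp (hXm.comp measurable_cons)).aestronglyMeasurable D
      (Filter.Eventually.of_forall fun _ => hD _)
  rw [h1, integral_prod _ hint, integral_fintype (Integrable.of_finite), Finset.mul_sum,
    ← Finset.sum_coe_sort B]
  refine Finset.sum_congr rfl fun b _ => ?_
  rw [integral_map hXm.aemeasurable (f := fun x => f (tau R b x))
    (hf.comp (hτ b)).aestronglyMeasurable]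
  have hb : (unif B).real {b} = 1 / (B.card : ℝ) := by
    rw [measureReal_def, unif, ProbabilityTheory.uniformOn_univ]
    simp
  rw [hb]
  simp only [hcons]
  rw [Complex.real_smul]
  push_cast
  rfl

end Existence

end WeightedFourier

/-! Let `T i` be the adjoint of the operator that sends e_c to α_i e_{l_i + Rc} for c dual to B (bc
∈ ℤ for all b ∈ B). The isometry condition gives ∑ ‖T_i v‖² = ‖v‖², and T_i e_t = ν_i(t) e_{g_i(t)}.
Hence ∑ |ν_i(t)|² = 1, and the |ν_i|² are the transition probabilities of a random walk t → g_i(t).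

Finite invariant sets consist of dual points (`isDual_of_mem_finite_invariant`), and minimal ones
are bounded, so there are finitely many. On a minimal set the walk returns to c almost surely
(`tendsto_avoid`). Prepending a letter to a word of Ω_c^{(0)} gives either another such word or a
cycle word, and the cycle words carry the total return probability 1. So the frame sum F satisfies
F(v) = ∑ F(T_i v) (`IsTransfer.frameSum_succ`, `IsTransfer.tsum_frame_eq`). Orthonormality of the
e_x on the union of the minimal sets starts an induction giving the Bessel bound
(`IsTransfer.sum_frameSum_le`), so the analysis operator A is a contraction.

The function d(t) = 1 - ‖A e_t‖² is then harmonic for the walk, real analytic, and zero at every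
chosen point. The maximum principle gives d ≤ 0 (`nonpos_of_harmonic`), so A preserves the norm of
every exponential. A contraction that preserves norms on a set with dense span is an isometry. -/

namespace WeightedFourier

/-! ### Exponentials -/

theorem norm_expFun (t x : ℝ) : ‖expFun t x‖ = 1 := by
  have h : expFun t x = Complex.exp (((2 * Real.pi * (t * x) : ℝ) : ℂ) * Complex.I) := by
    unfold expFun; push_cast; ring_nf
  rw [h, Complex.norm_exp_ofReal_mul_I]

theorem continuous_expFun (t : ℝ) : Continuous (expFun t) := by
  unfold expFun; fun_prop

theorem expFun_add (s t x : ℝ) : expFun (s + t) x = expFun s x * expFun t x := by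
  unfold expFun; rw [← Complex.exp_add]; push_cast; ring_nf

theorem conj_expFun (t x : ℝ) : (starRingEnd ℂ) (expFun t x) = expFun (-t) x := by
  unfold expFun
  rw [← Complex.exp_conj]
  simp only [map_mul, Complex.conj_ofReal, Complex.conj_I, map_ofNat]
  push_cast
  ring_nf

theorem expFun_comm (s t : ℝ) : expFun s t = expFun t s := by
  unfold expFun; ring_nf

theorem expFun_tau (R b : ℤ) (t x : ℝ) :
    expFun t (tau R b x) = expFun b ((R : ℝ)⁻¹ * t) * expFun ((R : ℝ)⁻¹ * t) x := by
  unfold expFun tau; rw [← Complex.exp_add]; push_cast; ring_nf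

theorem expFun_intCast (k : ℤ) {b x : ℝ} (h : b * x = k) : expFun b x = 1 := by
  unfold expFun
  rw [Complex.exp_eq_one_iff]
  refine ⟨k, ?_⟩
  rw [← Complex.ofReal_mul, h]
  push_cast; ring

theorem mB_eq (B : Finset ℤ) (t : ℝ) :
    mB B t = (1 / (B.card : ℂ)) * ∑ b ∈ B, expFun b t := by
  unfold mB expFun; push_cast; rfl

/-! ### Consequences of invariance -/

variable {R : ℤ} {B : Finset ℤ} {μ : Measure ℝ} [IsProbabilityMeasure μ]

theorem continuous_tau (R b : ℤ) : Continuous (tau R b) := by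
  unfold tau; fun_prop

theorem measurable_tau (R b : ℤ) : Measurable (tau R b) := (continuous_tau R b).measurable

/-- Testing invariance on indicators gives an identity of measures. It extends the integral formula
to all integrable functions, and the resulting domination `map_le` makes composition with τ_b well
defined on L² classes. -/
theorem IsInvariantMeasure.sum_map (hμ : IsInvariantMeasure R B μ) (hB : B.Nonempty) :
    ∑ b ∈ B, μ.map (tau R b) = (B.card : ENNReal) • μ := by
  ext A hA
  have hN : (B.card : ℂ) ≠ 0 := by simpa using hB.ne_empty
  have h := hμ (A.indicator fun _ => 1) (measurable_const.indicator hA)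
    ⟨1, fun x => by
      by_cases hx : x ∈ A <;> simp [hx]⟩
  have h2 : ∀ b : ℤ, (fun x => A.indicator (fun _ => (1 : ℂ)) (tau R b x)) =
      (tau R b ⁻¹' A).indicator fun _ => 1 := fun b => by
    ext x; by_cases hx : tau R b x ∈ A <;> simp [hx]
  simp only [h2] at h
  rw [integral_indicator_const _ hA] at h
  simp only [integral_indicator_const _ (measurable_tau R _ hA)] at h
  rw [one_div, eq_inv_mul_iff_mul_eq₀ hN] at h
  simp only [Complex.real_smul, mul_one] at h
  have h3 : (B.card : ℝ) * μ.real A = ∑ b ∈ B, μ.real (tau R b ⁻¹' A) := by exact_mod_cast h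
  simp only [Measure.coe_finsetSum, Finset.sum_apply, Measure.smul_apply, smul_eq_mul]
  rw [Finset.sum_congr rfl fun b _ => Measure.map_apply (measurable_tau R b) hA]
  rw [← ENNReal.toReal_eq_toReal_iff' (by simp) (by finiteness),
    ENNReal.toReal_sum (by simp), ENNReal.toReal_mul]
  simpa [measureReal_def] using h3.symm

theorem IsInvariantMeasure.map_le (hμ : IsInvariantMeasure R B μ) {b : ℤ} (hb : b ∈ B) :
    μ.map (tau R b) ≤ (B.card : ENNReal) • μ := by
  classical
  rw [← hμ.sum_map ⟨b, hb⟩]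
  rw [← Finset.add_sum_erase _ _ hb]
  exact Measure.le_add_right le_rfl

theorem IsInvariantMeasure.map_ac (hμ : IsInvariantMeasure R B μ) {b : ℤ} (hb : b ∈ B) :
    μ.map (tau R b) ≪ μ :=
  (Measure.absolutelyContinuous_of_le (hμ.map_le hb)).trans Measure.smul_absolutelyContinuous

theorem IsInvariantMeasure.quasi (hμ : IsInvariantMeasure R B μ) {b : ℤ} (hb : b ∈ B) :
    Measure.QuasiMeasurePreserving (tau R b) μ μ :=
  ⟨measurable_tau R b, hμ.map_ac hb⟩

theorem IsInvariantMeasure.memLp_comp (hμ : IsInvariantMeasure R B μ) {b : ℤ} (hb : b ∈ B)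
    {f : ℝ → ℂ} {p : ENNReal} (hf : MemLp f p μ) : MemLp (fun x => f (tau R b x)) p μ :=
  ((hf.smul_measure (by simp : (B.card : ENNReal) ≠ ⊤)).mono_measure
    (hμ.map_le hb)).comp_of_map (measurable_tau R b).aemeasurable

theorem IsInvariantMeasure.sum_integral {E : Type*} [NormedAddCommGroup E] [NormedSpace ℝ E]
    (hμ : IsInvariantMeasure R B μ) (hB : B.Nonempty) {f : ℝ → E} (hf : Integrable f μ) :
    ∑ b ∈ B, ∫ x, f (tau R b x) ∂μ = (B.card : ℝ) • ∫ x, f x ∂μ := by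
  have h1 : Integrable f ((B.card : ENNReal) • μ) := hf.smul_measure (by simp)
  have h2 := integral_smul_measure (μ := μ) f (B.card : ENNReal)
  rw [← hμ.sum_map hB, integral_finsetSum_measure
    (fun b hb => h1.mono_measure (hμ.map_le hb))] at h2
  simp only [ENNReal.toReal_natCast] at h2
  rw [← h2]
  refine Finset.sum_congr rfl fun b hb => ?_
  rw [integral_map (measurable_tau R b).aemeasurable
    (h1.mono_measure (hμ.map_le hb)).aestronglyMeasurable]

theorem IsInvariantMeasure.integrable_comp {E : Type*} [NormedAddCommGroup E]
    (hμ : IsInvariantMeasure R B μ) {b : ℤ} (hb : b ∈ B) {f : ℝ → E} (hf : Integrable f μ) :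
    Integrable (fun x => f (tau R b x)) μ :=
  ((hf.smul_measure (by simp : (B.card : ENNReal) ≠ ⊤)).mono_measure
    (hμ.map_le hb)).comp_measurable (measurable_tau R b)

/-! ### The transfer operators -/

/-- `x ↦ conj(α_i) N⁻¹ ∑_b e_{-l_i}(τ_b x) v(τ_b x)`. -/
noncomputable def transferFun (R : ℤ) (B : Finset ℤ) {m : ℕ} (l : Fin m → ℤ) (α : Fin m → ℂ)
    (i : Fin m) (v : ℝ → ℂ) (x : ℝ) : ℂ :=
  (starRingEnd ℂ) (α i) * ((1 / (B.card : ℂ)) *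
    ∑ b ∈ B, expFun (-(l i : ℝ)) (tau R b x) * v (tau R b x))

variable {m : ℕ} {l : Fin m → ℤ} {α : Fin m → ℂ}

theorem memLp_expFun_mul {μ : Measure ℝ} (t : ℝ) {v : ℝ → ℂ} (hv : MemLp v 2 μ) :
    MemLp (fun x => expFun t x * v x) 2 μ := by
  refine MemLp.of_le hv ((continuous_expFun t).aestronglyMeasurable.mul hv.1)
    (Filter.Eventually.of_forall fun x => ?_)
  rw [norm_mul, norm_expFun, one_mul]

theorem memLp_transferFun (hμ : IsInvariantMeasure R B μ) (i : Fin m) {v : ℝ → ℂ}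
    (hv : MemLp v 2 μ) : MemLp (transferFun R B l α i v) 2 μ := by
  unfold transferFun
  have h : MemLp (fun x => ∑ b ∈ B, expFun (-(l i : ℝ)) (tau R b x) * v (tau R b x)) 2 μ :=
    memLp_finsetSum B (f := fun b x => expFun (-(l i : ℝ)) (tau R b x) * v (tau R b x))
      fun b hb => hμ.memLp_comp hb (memLp_expFun_mul (-(l i : ℝ)) hv)
  exact (h.const_mul (1 / (B.card : ℂ))).const_mul _

/-- Since e_{-l_i}(τ_b x) is e_{-l_i/R}(x) times a conjugated matrix phase, T_i v(x) is, up to a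
unimodular factor, N^{-1/2} times the conjugate of the i-th entry of the matrix applied to the
vector of the conjugates of v(τ_b x). The matrix preserves the norm of that vector. -/
theorem sum_norm_sq_transferFun (hB : B.Nonempty)
    (hiso : (weightedMatrix R B l α).conjTranspose * weightedMatrix R B l α = 1)
    (v : ℝ → ℂ) (x : ℝ) :
    ∑ i, ‖transferFun R B l α i v x‖ ^ 2 =
      (B.card : ℝ)⁻¹ * ∑ b ∈ B, ‖v (tau R b x)‖ ^ 2 := by
  set W := weightedMatrix R B l α with hW
  set w : B → ℂ := fun b => (starRingEnd ℂ) (v (tau R b x)) with hw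
  have hN : (0 : ℝ) < B.card := by exact_mod_cast hB.card_pos
  have h1 : star (W.mulVec w) ⬝ᵥ W.mulVec w = star w ⬝ᵥ w := by
    rw [Matrix.star_mulVec, Matrix.dotProduct_mulVec, Matrix.vecMul_vecMul, hiso,
      Matrix.vecMul_one]
  have key : ∀ {ι : Type} [Fintype ι] (u : ι → ℂ), star u ⬝ᵥ u = ((∑ i, ‖u i‖ ^ 2 : ℝ) : ℂ) := by
    intro ι _ u
    simp only [dotProduct, Pi.star_apply, RCLike.star_def]
    push_cast
    exact Finset.sum_congr rfl fun i _ => Complex.conj_mul' _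
  rw [key, key] at h1
  have h2 : ∑ i, ‖W.mulVec w i‖ ^ 2 = ∑ b, ‖w b‖ ^ 2 := by exact_mod_cast h1
  have h3 : ∀ i, ‖transferFun R B l α i v x‖ ^ 2 = (B.card : ℝ)⁻¹ * ‖W.mulVec w i‖ ^ 2 := by
    intro i
    have h4 : transferFun R B l α i v x = expFun (-((R : ℝ)⁻¹ * l i)) x *
        (((1 / Real.sqrt B.card : ℝ) : ℂ) * (starRingEnd ℂ) (W.mulVec w i)) := by
      simp only [transferFun, Matrix.mulVec, dotProduct, map_sum, map_mul]
      have h5 : ((1 / Real.sqrt B.card : ℝ) : ℂ) * ((1 / Real.sqrt B.card : ℝ) : ℂ) =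
          1 / (B.card : ℂ) := by
        rw [← Complex.ofReal_mul]
        have : (1 / Real.sqrt B.card) * (1 / Real.sqrt B.card) = 1 / (B.card : ℝ) := by
          rw [div_mul_div_comm, Real.mul_self_sqrt hN.le, one_mul]
        rw [this]; push_cast; rfl
      rw [← Finset.sum_coe_sort B, ← h5]
      simp only [Finset.mul_sum]
      refine Finset.sum_congr rfl fun b _ => ?_
      have h6 : expFun (-(l i : ℝ)) (tau R b x) = expFun (-((R : ℝ)⁻¹ * l i)) x *
          (starRingEnd ℂ) (Complex.exp (2 * Real.pi * Complex.I * ((R : ℂ)⁻¹ * (b : ℤ) * l i))) := by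
        rw [expFun_tau, mul_neg, mul_comm]
        congr 1
        have h7 : Complex.exp (2 * Real.pi * Complex.I * ((R : ℂ)⁻¹ * (b : ℤ) * l i)) =
            expFun ((R : ℝ)⁻¹ * l i) (b : ℤ) := by
          unfold expFun; push_cast; ring_nf
        rw [h7, conj_expFun, expFun_comm]
      rw [h6, hW, hw]
      simp only [weightedMatrix, map_mul, Complex.conj_ofReal, Complex.conj_conj]
      ring
    rw [h4, norm_mul, norm_expFun, one_mul, norm_mul, mul_pow, RCLike.norm_conj,
      Complex.norm_real, Real.norm_eq_abs, sq_abs, div_pow, Real.sq_sqrt hN.le]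
    simp
  simp only [h3, ← Finset.mul_sum, h2]
  rw [← Finset.sum_coe_sort B]
  simp [hw]

theorem norm_sq_eq_integral {μ : Measure ℝ} (v : Lp ℂ 2 μ) : ‖v‖ ^ 2 = ∫ x, ‖v x‖ ^ 2 ∂μ := by
  have h : inner ℂ v v = ((∫ x, ‖v x‖ ^ 2 ∂μ : ℝ) : ℂ) := by
    rw [L2.inner_def]
    refine (integral_congr_ae (Filter.Eventually.of_forall fun x => ?_)).trans integral_ofReal
    simp [inner_self_eq_norm_sq_to_K]
  rw [inner_self_eq_norm_sq_to_K] at h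
  exact Complex.ofReal_injective (by simpa using h)

theorem norm_expLp (t : ℝ) : ‖expLp μ t‖ = 1 := by
  have h : ‖expLp μ t‖ ^ 2 = 1 := by
    rw [norm_sq_eq_integral]
    have : (fun x => ‖expLp μ t x‖ ^ 2) =ᵐ[μ] fun _ => 1 := by
      filter_upwards [(memLp_expFun μ t).coeFn_toLp] with x hx
      rw [expLp, hx, norm_expFun, one_pow]
    rw [integral_congr_ae this]; simp
  nlinarith [norm_nonneg (expLp μ t)]

theorem inner_expLp (t : ℝ) (v : Lp ℂ 2 μ) :
    inner ℂ (expLp μ t) v = ∫ x, expFun (-t) x * v x ∂μ := by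
  rw [L2.inner_def]
  refine integral_congr_ae ?_
  filter_upwards [(memLp_expFun μ t).coeFn_toLp] with x hx
  rw [expLp, hx, RCLike.inner_apply, conj_expFun, mul_comm]

/-- `b c` is an integer for all `b ∈ B`. -/
def IsDual (B : Finset ℤ) (c : ℝ) : Prop := ∀ b ∈ B, ∃ k : ℤ, (b : ℝ) * c = k

theorem exists_transfer (hR : R ≠ 0) (hB : B.Nonempty) (hμ : IsInvariantMeasure R B μ)
    (hiso : (weightedMatrix R B l α).conjTranspose * weightedMatrix R B l α = 1) :
    ∃ T : Fin m → Lp ℂ 2 μ → Lp ℂ 2 μ, (∀ v, ∑ i, ‖T i v‖ ^ 2 = ‖v‖ ^ 2) ∧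
      (∀ i c v, IsDual B c → inner ℂ (expLp μ c) (T i v) =
        (starRingEnd ℂ) (α i) * inner ℂ (expLp μ (l i + R * c)) v) ∧
      ∀ i t, T i (expLp μ t) = nu R B l α i t • expLp μ (g R l i t) := by
  have hN : (B.card : ℝ) ≠ 0 := by exact_mod_cast hB.card_pos.ne'
  refine ⟨fun i v => (memLp_transferFun (l := l) (α := α) hμ i (Lp.memLp v)).toLp _, fun v => ?_,
    fun i c v hc => ?_, fun i t => ?_⟩
  · simp only [norm_sq_eq_integral]
    have h1 : ∀ i, ∫ x, ‖((memLp_transferFun (l := l) (α := α) hμ i (Lp.memLp v)).toLp _) x‖ ^ 2 ∂μ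
        = ∫ x, ‖transferFun R B l α i v x‖ ^ 2 ∂μ := fun i => by
      refine integral_congr_ae ?_
      filter_upwards [(memLp_transferFun (l := l) (α := α) hμ i (Lp.memLp v)).coeFn_toLp] with x hx
      rw [hx]
    have hv : Integrable (fun x => ‖v x‖ ^ 2) μ := (Lp.memLp v).integrable_norm_pow (by norm_num)
    rw [Finset.sum_congr rfl fun i _ => h1 i, ← integral_finsetSum _ fun i _ =>
      (memLp_transferFun (l := l) (α := α) hμ i (Lp.memLp v)).integrable_norm_pow (by norm_num)]
    simp only [sum_norm_sq_transferFun hB hiso]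
    rw [integral_const_mul, integral_finsetSum _ fun b hb => hμ.integrable_comp hb hv,
      hμ.sum_integral hB hv, smul_eq_mul, inv_mul_cancel_left₀ hN]
  · rw [inner_expLp, inner_expLp]
    have h1 : (fun x => expFun (-c) x *
        ((memLp_transferFun (l := l) (α := α) hμ i (Lp.memLp v)).toLp _) x) =ᵐ[μ]
        fun x => (starRingEnd ℂ) (α i) * ((1 / (B.card : ℂ)) *
          ∑ b ∈ B, expFun (-(l i + R * c)) (tau R b x) * v (tau R b x)) := by
      filter_upwards [(memLp_transferFun (l := l) (α := α) hμ i (Lp.memLp v)).coeFn_toLp] with x hx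
      rw [hx, transferFun, mul_left_comm, mul_left_comm (expFun (-c) x), Finset.mul_sum]
      congr 2
      refine Finset.sum_congr rfl fun b hb => ?_
      rw [← mul_assoc, neg_add, expFun_add, mul_comm (expFun (-c) x)]
      congr 2
      -- Duality enters here: e_{Rc}(τ_b x) = e_c(x) for every b ∈ B, so e_c can be carried under
      -- the sum over b.
      obtain ⟨k, hk⟩ := hc b hb
      have hR' : (R : ℝ) ≠ 0 := by exact_mod_cast hR
      have : (R : ℝ)⁻¹ * -(R * c) = -c := by field_simp
      have hb1 : expFun b (-c) = 1 := expFun_intCast (-k) (by push_cast; linarith)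
      rw [expFun_tau, this, hb1, one_mul]
    have hint : Integrable (fun x => expFun (-(l i + R * c)) x * v x) μ :=
      (memLp_expFun_mul _ (Lp.memLp v)).integrable (by norm_num)
    rw [integral_congr_ae h1, integral_const_mul, integral_const_mul,
      integral_finsetSum _ fun b hb => hμ.integrable_comp hb hint, hμ.sum_integral hB hint,
      Complex.real_smul]
    have hN' : (B.card : ℂ) ≠ 0 := by exact_mod_cast hN
    push_cast
    field_simp
  · refine Lp.ext ?_
    have hq : ∀ b ∈ B, ∀ᵐ x ∂μ, expLp μ t (tau R b x) = expFun t (tau R b x) := fun b hb =>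
      (hμ.quasi hb).ae ((memLp_expFun μ t).coeFn_toLp)
    have hq' := (Filter.eventually_all_finset B).2 hq
    filter_upwards [(memLp_transferFun (l := l) (α := α) hμ i (Lp.memLp (expLp μ t))).coeFn_toLp,
      hq', (memLp_expFun μ (g R l i t)).coeFn_toLp,
      Lp.coeFn_smul (nu R B l α i t) (expLp μ (g R l i t))] with x h1 h2 h3 h4
    change expLp μ (g R l i t) x = _ at h3
    rw [h1, h4, Pi.smul_apply, h3, smul_eq_mul, nu, mB_eq, transferFun, mul_assoc,
      mul_assoc, Finset.sum_mul]
    congr 2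
    refine Finset.sum_congr rfl fun b hb => ?_
    rw [h2 b hb, ← expFun_add, expFun_tau]
    simp only [g]
    ring_nf

end WeightedFourier

/-! ### Density of the exponentials in L²(μ) and analyticity of t ↦ e_t -/

namespace WeightedFourier

/-! ### Exponentials span `L²(μ)` -/

/-- The finite measures with densities h⁺ and h⁻ have the same characteristic function, hence
coincide. -/
theorem ae_eq_zero_of_integral_expFun_real {μ : Measure ℝ} {h : ℝ → ℝ} (hh : Integrable h μ)
    (h0 : ∀ t, ∫ x, expFun t x * (h x : ℂ) ∂μ = 0) : h =ᵐ[μ] 0 := by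
  have f1 : IsFiniteMeasure (μ.withDensity fun x => ENNReal.ofReal (h x)) :=
    isFiniteMeasure_withDensity_ofReal hh.2
  have f2 : IsFiniteMeasure (μ.withDensity fun x => ENNReal.ofReal (-h x)) :=
    isFiniteMeasure_withDensity_ofReal hh.neg.2
  have m1 : AEMeasurable (fun x => ENNReal.ofReal (h x)) μ := hh.1.aemeasurable.ennreal_ofReal
  have m2 : AEMeasurable (fun x => ENNReal.ofReal (-h x)) μ :=
    hh.1.aemeasurable.neg.ennreal_ofReal
  have hbd : ∀ (s : ℝ) (k : ℝ → ℝ), Integrable k μ →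
      Integrable (fun x => ((max (k x) 0 : ℝ) : ℂ) * expFun s x) μ := by
    intro s k hk
    refine (hk.pos_part.ofReal (𝕜 := ℂ)).mul_bdd (c := 1)
      (continuous_expFun s).aestronglyMeasurable ?_
    exact Filter.Eventually.of_forall fun x => (norm_expFun s x).le
  have heq : (μ.withDensity fun x => ENNReal.ofReal (h x)) =
      μ.withDensity fun x => ENNReal.ofReal (-h x) := by
    refine Measure.ext_of_charFun (funext fun t => ?_)
    have hexp : ∀ x : ℝ, Complex.exp (t * x * Complex.I) = expFun (t / (2 * Real.pi)) x := by
      intro x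
      unfold expFun
      congr 1
      push_cast
      have : (Real.pi : ℂ) ≠ 0 := by exact_mod_cast Real.pi_ne_zero
      field_simp
    rw [charFun_apply_real, charFun_apply_real,
      integral_withDensity_eq_integral_toReal_smul₀ m1 (by simp),
      integral_withDensity_eq_integral_toReal_smul₀ m2 (by simp)]
    simp only [hexp, ENNReal.toReal_ofReal', Complex.real_smul]
    rw [← sub_eq_zero, ← integral_sub (hbd _ _ hh) (hbd _ (fun x => -h x) hh.neg),
      ← h0 (t / (2 * Real.pi))]
    refine integral_congr_ae (Filter.Eventually.of_forall fun x => ?_)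
    have : h x = max (h x) 0 - max (-h x) 0 := by
      rcases le_total 0 (h x) with hx | hx
      · rw [max_eq_left hx, max_eq_right (by linarith)]; ring
      · rw [max_eq_right hx, max_eq_left (by linarith)]; ring
    simp only
    conv_rhs => rw [this]
    push_cast
    ring
  rw [withDensity_eq_iff m1 m2 ((lintegral_ofReal_le_lintegral_enorm h).trans_lt hh.2).ne] at heq
  filter_upwards [heq] with x hx
  have := congrArg ENNReal.toReal hx
  simp only [ENNReal.toReal_ofReal'] at this
  rcases le_total 0 (h x) with hx | hx
  · rw [max_eq_left hx, max_eq_right (by linarith)] at this; simpa using this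
  · rw [max_eq_right hx, max_eq_left (by linarith)] at this; simp; linarith

variable {R : ℤ} {B : Finset ℤ} {μ : Measure ℝ} [IsProbabilityMeasure μ]

/-- The exponentials are closed under conjugation, so they also annihilate the conjugate of v; the
real and imaginary parts can be treated separately. -/
theorem eq_zero_of_inner_expLp {v : Lp ℂ 2 μ} (h : ∀ t, inner ℂ (expLp μ t) v = 0) : v = 0 := by
  have hv : Integrable v μ := (Lp.memLp v).integrable (by norm_num)
  have h1 : ∀ t, ∫ x, expFun t x * v x ∂μ = 0 := fun t => by
    have := h (-t); rwa [inner_expLp, neg_neg] at this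
  have h2 : ∀ t, ∫ x, expFun t x * (starRingEnd ℂ) (v x) ∂μ = 0 := fun t => by
    have := congrArg (starRingEnd ℂ) (h1 (-t))
    rw [← integral_conj, map_zero] at this
    simpa only [map_mul, conj_expFun, neg_neg] using this
  have hi : ∀ (t : ℝ) (k : ℝ → ℂ), Integrable k μ → Integrable (fun x => expFun t x * k x) μ := by
    intro t k hk
    exact hk.bdd_mul (c := 1) (continuous_expFun t).aestronglyMeasurable
      (Filter.Eventually.of_forall fun x => (norm_expFun t x).le)
  have hvc : Integrable (fun x => (starRingEnd ℂ) (v x)) μ :=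
    (LinearIsometryEquiv.integrable_comp_iff Complex.conjLIE).2 hv
  have hre := ae_eq_zero_of_integral_expFun_real (h := fun x => (v x).re) hv.re fun t => by
    have : ∀ x, expFun t x * ((v x).re : ℂ) =
        (1 / 2) * (expFun t x * v x + expFun t x * (starRingEnd ℂ) (v x)) := fun x => by
      rw [Complex.re_eq_add_conj]; ring
    simp only [this]
    rw [integral_const_mul, integral_add (hi _ _ hv) (hi _ _ hvc), h1, h2]; simp
  have him := ae_eq_zero_of_integral_expFun_real (h := fun x => (v x).im) hv.im fun t => by
    have : ∀ x, expFun t x * ((v x).im : ℂ) =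
        (1 / (2 * Complex.I)) * (expFun t x * v x - expFun t x * (starRingEnd ℂ) (v x)) :=
      fun x => by rw [Complex.im_eq_sub_conj]; ring
    simp only [this]
    rw [integral_const_mul, integral_sub (hi _ _ hv) (hi _ _ hvc), h1, h2]; simp
  refine Lp.ext ?_
  filter_upwards [hre, him, Lp.coeFn_zero ℂ 2 μ] with x hx hy h0
  rw [h0]
  exact Complex.ext hx hy

theorem topologicalClosure_span_expLp :
    (Submodule.span ℂ (Set.range (expLp μ))).topologicalClosure = ⊤ := by
  rw [Submodule.topologicalClosure_eq_top_iff, Submodule.eq_bot_iff]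
  intro v hv
  refine eq_zero_of_inner_expLp fun t => ?_
  exact (Submodule.mem_orthogonal _ _).1 hv _ (Submodule.subset_span ⟨t, rfl⟩)

/-! ### Compact support and analyticity -/

/-- If s ≥ C + 1 and |τ_b x| > s, then |x| > 2s - C ≥ s + 1. By invariance the mass outside [-s, s]
is at most the mass outside [-s-1, s+1]; iterating pushes it to infinity. -/
theorem IsInvariantMeasure.ae_abs_le (hμ : IsInvariantMeasure R B μ) (hR : 1 < |R|)
    (hB : B.Nonempty) : ∃ r : ℝ, ∀ᵐ x ∂μ, |x| ≤ r := by
  obtain ⟨C, hC⟩ : ∃ C : ℝ, ∀ b ∈ B, |(b : ℝ)| ≤ C :=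
    ⟨∑ b ∈ B, |(b : ℝ)|, fun b hb =>
      Finset.single_le_sum (f := fun b : ℤ => |(b : ℝ)|) (fun _ _ => abs_nonneg _) hb⟩
  have hC0 : 0 ≤ C := (abs_nonneg _).trans (hC _ hB.choose_spec)
  have hR2 : (2 : ℝ) ≤ |(R : ℝ)| := by exact_mod_cast hR
  have hmeas : ∀ s : ℝ, MeasurableSet {x : ℝ | s < |x|} := fun s =>
    measurableSet_lt measurable_const (by fun_prop)
  have hN : (B.card : ENNReal) ≠ 0 := by simpa using hB.ne_empty
  have step : ∀ s : ℝ, C + 1 ≤ s → μ {x : ℝ | s < |x|} ≤ μ {x : ℝ | s + 1 < |x|} := by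
    intro s hs
    have h1 := congrArg (fun ν : Measure ℝ => ν {x : ℝ | s < |x|}) (hμ.sum_map hB)
    simp only [Measure.coe_finsetSum, Finset.sum_apply, Measure.smul_apply, smul_eq_mul] at h1
    have h2 : ∀ b ∈ B, μ.map (tau R b) {x : ℝ | s < |x|} ≤ μ {x : ℝ | s + 1 < |x|} := by
      intro b hb
      rw [Measure.map_apply (measurable_tau R b) (hmeas s)]
      refine measure_mono fun x hx => ?_
      simp only [tau, Set.preimage_ofPred_eq, Set.mem_ofPred_eq, abs_mul, abs_inv] at hx ⊢
      rw [inv_mul_eq_div, lt_div_iff₀ (by linarith)] at hx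
      have := abs_add_le x b
      have := hC b hb
      nlinarith
    have h3 := Finset.sum_le_sum h2
    rw [h1, Finset.sum_const, nsmul_eq_mul] at h3
    exact (ENNReal.mul_le_mul_iff_right hN (by simp)).1 h3
  have hn : ∀ n : ℕ, μ {x : ℝ | C + 1 < |x|} ≤ μ {x : ℝ | C + 1 + n < |x|} := by
    intro n
    induction n with
    | zero => simp
    | succ n ih =>
      refine ih.trans ((step _ (by simp)).trans_eq ?_)
      push_cast; ring_nf
  have hlim : Filter.Tendsto (fun n : ℕ => μ {x : ℝ | C + 1 + n < |x|}) Filter.atTop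
      (nhds (μ (⋂ n : ℕ, {x : ℝ | C + 1 + n < |x|}))) :=
    tendsto_measure_iInter_atTop (fun n => (hmeas _).nullMeasurableSet)
      (fun a b hab x hx => by
        have : (a : ℝ) ≤ b := by exact_mod_cast hab
        simp only [Set.mem_ofPred_eq] at hx ⊢; linarith) ⟨0, by finiteness⟩
  have hempty : (⋂ n : ℕ, {x : ℝ | C + 1 + n < |x|}) = ∅ := by
    refine Set.eq_empty_of_forall_notMem fun x hx => ?_
    obtain ⟨n, hn⟩ := exists_nat_gt |x|
    have := Set.mem_iInter.1 hx n
    simp only [Set.mem_ofPred_eq] at this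
    linarith
  rw [hempty, measure_empty] at hlim
  refine ⟨C + 1, ?_⟩
  rw [ae_iff]
  simp only [not_le]
  exact le_antisymm (ge_of_tendsto' hlim hn) zero_le

/-- The exponent `⊤` means analytic, not merely C^∞. Because μ has bounded support, e_t agrees
almost everywhere with exp(tψ) in the Banach algebra of bounded continuous functions, where ψ is
2πix with x truncated to the support bound. -/
theorem IsInvariantMeasure.contDiff_expLp (hμ : IsInvariantMeasure R B μ) (hR : 1 < |R|)
    (hB : B.Nonempty) : ContDiff ℝ ⊤ (expLp μ) := by
  obtain ⟨r, hr⟩ := hμ.ae_abs_le hR hB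
  let ψ : BoundedContinuousFunction ℝ ℂ := BoundedContinuousFunction.ofNormedAddCommGroup
    (fun x => 2 * Real.pi * Complex.I * ((max (-r) (min r x) : ℝ) : ℂ)) (by fun_prop)
    (2 * Real.pi * |r|) (fun x => by
      rw [norm_mul, Complex.norm_real, norm_mul, Complex.norm_I, mul_one, norm_mul,
        Complex.norm_real, Real.norm_of_nonneg Real.pi_pos.le]
      simp only [Complex.norm_ofNat]
      gcongr
      rw [Real.norm_eq_abs]
      rcases le_total 0 r with h | h
      · rw [abs_of_nonneg h, abs_le]
        exact ⟨le_max_left _ _, max_le (by linarith) (min_le_left _ _)⟩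
      · rw [max_eq_left ((min_le_left _ _).trans (by linarith)), abs_neg])
  have key : expLp μ = fun t : ℝ =>
      BoundedContinuousFunction.toLp 2 μ ℝ (NormedSpace.exp (t • ψ)) := by
    ext1 t
    refine Lp.ext ?_
    filter_upwards [(memLp_expFun μ t).coeFn_toLp,
      BoundedContinuousFunction.coeFn_toLp (p := 2) μ ℝ (NormedSpace.exp (t • ψ)), hr]
      with x h1 h2 h3
    rw [expLp, h1, h2]
    let ev : BoundedContinuousFunction ℝ ℂ →+* ℂ :=
      { toFun := fun f => f x, map_one' := rfl, map_mul' := fun _ _ => rfl, map_zero' := rfl,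
        map_add' := fun _ _ => rfl }
    have hev : Continuous ev := continuous_eval_const x
    have h4 : (NormedSpace.exp (t • ψ)) x = NormedSpace.exp ((t • ψ) x) :=
      NormedSpace.map_exp ev hev (t • ψ)
    rw [h4, ← Complex.exp_eq_exp_ℂ]
    unfold expFun
    congr 1
    have h5 : max (-r) (min r x) = x := by
      rw [abs_le] at h3
      rw [min_eq_right h3.2, max_eq_right h3.1]
    simp only [BoundedContinuousFunction.coe_smul, ψ,
      BoundedContinuousFunction.coe_ofNormedAddCommGroup, h5, Complex.real_smul]
    ring
  rw [key]
  have hexp : ContDiff ℝ ⊤ (NormedSpace.exp : BoundedContinuousFunction ℝ ℂ → _) := by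
    rw [contDiff_omega_iff_analyticOnNhd]
    exact fun x _ => NormedSpace.exp_analytic (𝕂 := ℝ) x
  exact (ContinuousLinearMap.contDiff _).comp (hexp.comp (contDiff_id.smul contDiff_const))

end WeightedFourier

/-! ### Words, duality and minimal finite invariant sets -/

namespace WeightedFourier

variable {R : ℤ} {B : Finset ℤ} {m : ℕ} {l : Fin m → ℤ} {α : Fin m → ℂ}

/-! ### Words -/

theorem add_mul_g (hR : R ≠ 0) (i : Fin m) (x : ℝ) : l i + R * g R l i x = x := by
  have : (R : ℝ) ≠ 0 := by exact_mod_cast hR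
  unfold g; field_simp; ring

theorem g_add_mul (hR : R ≠ 0) (i : Fin m) (x : ℝ) : g R l i (l i + R * x) = x := by
  have : (R : ℝ) ≠ 0 := by exact_mod_cast hR
  unfold g; field_simp; ring

theorem g_injective (hR : R ≠ 0) (i : Fin m) : Function.Injective (g R l i) := fun x y h => by
  rw [← add_mul_g (l := l) hR i x, h, add_mul_g hR]

theorem gWord_injective (hR : R ≠ 0) (ω : List (Fin m)) : Function.Injective (gWord R l ω) := by
  induction ω with
  | nil => exact fun x y h => h
  | cons i ω ih => exact fun x y h => g_injective hR i (ih h)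

theorem gWord_append (ω ω' : List (Fin m)) (t : ℝ) :
    gWord R l (ω ++ ω') t = gWord R l ω' (gWord R l ω t) := by
  induction ω generalizing t with
  | nil => rfl
  | cons i ω ih => exact ih _

theorem wordFreq_nil (c : ℝ) : wordFreq R l [] c = c := by simp [wordFreq]

theorem wordFreq_cons (i : Fin m) (ω : List (Fin m)) (c : ℝ) :
    wordFreq R l (i :: ω) c = l i + R * wordFreq R l ω c := by
  unfold wordFreq
  have h : ∑ k : Fin (i :: ω).length, (R : ℝ) ^ (k : ℕ) * l ((i :: ω).get k) = l i +
      ∑ k : Fin ω.length, (R : ℝ) ^ ((k : ℕ) + 1) * l (ω.get k) := by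
    refine (Fin.sum_univ_succ _).trans ?_
    simp
  rw [h, List.length_cons]
  simp only [pow_succ, mul_add, Finset.mul_sum]
  rw [add_assoc]
  congr 2
  · exact Finset.sum_congr rfl fun k _ => by ring
  · ring

/-- Each g_i inverts x ↦ l_i + Rx, so the frequency attached to ω is the unique point from which the
path ω leads to c. -/
theorem gWord_wordFreq (hR : R ≠ 0) (ω : List (Fin m)) (c : ℝ) :
    gWord R l ω (wordFreq R l ω c) = c := by
  induction ω with
  | nil => exact wordFreq_nil c
  | cons i ω ih => rw [wordFreq_cons, gWord, g_add_mul hR, ih]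

theorem wordFreq_eq_of_gWord (hR : R ≠ 0) {ω : List (Fin m)} {c : ℝ} (h : gWord R l ω c = c) :
    wordFreq R l ω c = c :=
  gWord_injective hR ω ((gWord_wordFreq hR ω c).trans h.symm)

theorem IsDual.add_mul {c : ℝ} (hc : IsDual B c) (a : ℤ) : IsDual B (a + R * c) := by
  intro b hb
  obtain ⟨k, hk⟩ := hc b hb
  exact ⟨b * a + R * k, by push_cast; rw [← hk]; ring⟩

theorem IsDual.wordFreq {c : ℝ} (hc : IsDual B c) (ω : List (Fin m)) :
    IsDual B (wordFreq R l ω c) := by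
  induction ω with
  | nil => rwa [wordFreq_nil]
  | cons i ω ih => rw [wordFreq_cons]; exact ih.add_mul _

theorem IsDual.mB_eq_one (hB : 0 ∈ B) {c : ℝ} (hc : IsDual B c) : mB B c = 1 := by
  have hN : (B.card : ℂ) ≠ 0 := by exact_mod_cast (Finset.card_pos.2 ⟨0, hB⟩).ne'
  rw [mB_eq, Finset.sum_congr rfl fun b hb => expFun_intCast _ (hc b hb).choose_spec]
  simp [hN]

theorem isDual_intCast (k : ℤ) : IsDual B k := fun b _ => ⟨b * k, by push_cast; rfl⟩

theorem nu_of_isDual_g (hB : 0 ∈ B) {i : Fin m} {x : ℝ} (h : IsDual B (g R l i x)) :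
    nu R B l α i x = (starRingEnd ℂ) (α i) := by
  rw [nu, h.mB_eq_one hB, mul_one]

theorem nuWord_wordFreq (hR : R ≠ 0) (hB : 0 ∈ B) {c : ℝ} (hc : IsDual B c)
    (ω : List (Fin m)) :
    nuWord R B l α ω (wordFreq R l ω c) = (starRingEnd ℂ) (ω.map α).prod := by
  induction ω with
  | nil => simp [nuWord]
  | cons i ω ih =>
    have h := g_add_mul (l := l) hR i (wordFreq R l ω c)
    rw [wordFreq_cons, nuWord, h, ih, nu_of_isDual_g hB (by rw [h]; exact hc.wordFreq ω),
      List.map_cons, List.prod_cons, map_mul]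

/-! ### Finite invariant sets consist of points dual to `B` -/

theorem norm_mB_le_one (B : Finset ℤ) (t : ℝ) : ‖mB B t‖ ≤ 1 := by
  rw [mB_eq, norm_mul]
  have h : ‖∑ b ∈ B, expFun b t‖ ≤ B.card := by
    refine (norm_sum_le _ _).trans_eq ?_
    simp [norm_expFun]
  rcases Nat.eq_zero_or_pos B.card with h0 | h0
  · simp [h0]
  · rw [norm_div, norm_one, Complex.norm_natCast, one_div, inv_mul_le_iff₀ (by exact_mod_cast h0)]
    simpa using h

/-- Equality in the triangle inequality: the term of 0 ∈ B equals 1, so every other unimodular term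
must equal 1 as well. -/
theorem isDual_of_one_le_norm_mB (hB : 0 ∈ B) {t : ℝ} (h : 1 ≤ ‖mB B t‖) : IsDual B t := by
  classical
  intro b hb
  by_cases hb0 : b = 0
  · exact ⟨0, by simp [hb0]⟩
  have hN : (0 : ℝ) < B.card := by exact_mod_cast Finset.card_pos.2 ⟨0, hB⟩
  rw [mB_eq, norm_mul, norm_div, norm_one, Complex.norm_natCast, one_div, ← div_eq_inv_mul,
    one_le_div hN] at h
  have hb' : b ∈ B.erase 0 := Finset.mem_erase.2 ⟨hb0, hb⟩
  rw [← Finset.add_sum_erase _ _ hB, ← Finset.add_sum_erase _ _ hb', ← add_assoc] at h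
  have h1 : ‖∑ x ∈ (B.erase 0).erase b, expFun x t‖ ≤ (B.card : ℝ) - 2 := by
    refine (norm_sum_le _ _).trans ?_
    simp only [norm_expFun, Finset.sum_const, nsmul_eq_mul, mul_one]
    have h3 := Finset.card_erase_add_one hb'
    have h4 := Finset.card_erase_add_one hB
    have : (((B.erase 0).erase b).card : ℝ) + 2 = B.card := by
      rw [← h4, ← h3]; push_cast; ring
    linarith
  have h0 : expFun ((0 : ℤ) : ℝ) t = 1 := by simp [expFun]
  have h2 := (h.trans (norm_add_le _ _)).trans (add_le_add_right h1 _)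
  rw [h0] at h2
  have h3 : 2 ≤ ‖1 + expFun b t‖ := by linarith
  have hn := norm_expFun b t
  have h5 : expFun b t = 1 := by
    have e1 : ‖1 + expFun b t‖ ^ 2 = (1 + (expFun b t).re) ^ 2 + (expFun b t).im ^ 2 := by
      rw [← Complex.normSq_eq_norm_sq, Complex.normSq_apply]; simp; ring
    have e2 : ‖expFun b t‖ ^ 2 = (expFun b t).re ^ 2 + (expFun b t).im ^ 2 := by
      rw [← Complex.normSq_eq_norm_sq, Complex.normSq_apply]; ring
    rw [hn] at e2
    have hre : (expFun b t).re = 1 := by nlinarith [sq_nonneg (expFun b t).im]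
    refine Complex.ext hre ?_
    rw [hre] at e2
    simp only [Complex.one_im]
    nlinarith
  unfold expFun at h5
  obtain ⟨k, hk⟩ := Complex.exp_eq_one_iff.1 h5
  refine ⟨k, ?_⟩
  have hpi : (2 * Real.pi * Complex.I : ℂ) ≠ 0 := Complex.two_pi_I_ne_zero
  rw [mul_comm (k : ℂ)] at hk
  exact_mod_cast mul_left_cancel₀ hpi hk

theorem mB_add_intCast (t : ℝ) (k : ℤ) : mB B (t + k) = mB B t := by
  rw [mB_eq, mB_eq]
  congr 1
  refine Finset.sum_congr rfl fun b _ => ?_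
  rw [expFun_comm, expFun_add, expFun_comm t, expFun_intCast (k * b) (b := k) (by push_cast; rfl),
    mul_one]

theorem mB_fract (t : ℝ) : mB B (Int.fract t) = mB B t := by
  conv_rhs => rw [← Int.fract_add_floor t, mB_add_intCast]

/-- For these digits g_i(ρ) is an integer, so |ν_i(ρ)| = |α_i|; the bound is part of the total
probability 1 at ρ. -/
theorem sum_norm_sq_residue_le_one (hR : R ≠ 0) (hB : 0 ∈ B)
    (hν : ∀ t, ∑ i, ‖nu R B l α i t‖ ^ 2 = 1) (s : Finset (Fin m)) (ρ : ℝ)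
    (hs : ∀ i ∈ s, ∃ k : ℤ, (l i : ℝ) = ρ + R * k) : ∑ i ∈ s, ‖α i‖ ^ 2 ≤ 1 := by
  have hR' : (R : ℝ) ≠ 0 := by exact_mod_cast hR
  rw [← hν ρ]
  refine le_trans (Finset.sum_le_sum fun i hi => ?_)
    (Finset.sum_le_sum_of_subset_of_nonneg (Finset.subset_univ s) fun _ _ _ => by positivity)
  obtain ⟨k, hk⟩ := hs i hi
  have h : g R l i ρ = ((-k : ℤ) : ℝ) := by
    unfold g; rw [hk]; push_cast; field_simp; ring
  rw [nu_of_isDual_g hB (by rw [h]; exact isDual_intCast _), RCLike.norm_conj]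

/-- A count modulo 1. Let M be the set of classes of S. From s ∈ S the walk enters only classes y ∈
M with Ry ≡ s, and enters y with probability at most |m_B(y)|², so these |m_B(y)|² sum to at least
1. Each y lies over at most one class of M, so summing over M gives |M| ≤ ∑ |m_B(y)|² ≤ |M|. Hence
|m_B| = 1 throughout M. -/
theorem isDual_of_mem_finite_invariant (hR : R ≠ 0) (hB : 0 ∈ B)
    (hν : ∀ t, ∑ i, ‖nu R B l α i t‖ ^ 2 = 1) {S : Set ℝ} (hfin : S.Finite)
    (hS : IsInvariantSet R B l α S) {c : ℝ} (hc : c ∈ S) : IsDual B c := by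
  classical
  have hR' : (R : ℝ) ≠ 0 := by exact_mod_cast hR
  set M := hfin.toFinset.image Int.fract with hM
  have hmem : ∀ x ∈ S, Int.fract x ∈ M := fun x hx =>
    Finset.mem_image_of_mem _ (hfin.mem_toFinset.2 hx)
  have hfib : ∀ x ∈ M, 1 ≤ ∑ y ∈ M with Int.fract ((R : ℝ) * y) = x, ‖mB B y‖ ^ 2 := by
    intro x hx
    obtain ⟨s, hs, rfl⟩ := Finset.mem_image.1 hx
    rw [hfin.mem_toFinset] at hs
    have h1 : ∑ i with nu R B l α i s ≠ 0, ‖nu R B l α i s‖ ^ 2 = 1 := by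
      rw [← hν s, Finset.sum_filter]
      refine Finset.sum_congr rfl fun i _ => ?_
      split_ifs with h
      · rfl
      · simp only [not_not] at h; simp [h]
    rw [← h1, ← Finset.sum_fiberwise_of_maps_to (g := fun i => Int.fract (g R l i s))
      (t := M.filter fun y => Int.fract ((R : ℝ) * y) = Int.fract s)]
    · refine Finset.sum_le_sum fun y _ => ?_
      calc ∑ i ∈ _ with Int.fract (g R l i s) = y, ‖nu R B l α i s‖ ^ 2
          = (∑ i ∈ (Finset.univ.filter fun i => nu R B l α i s ≠ 0) with
              Int.fract (g R l i s) = y, ‖α i‖ ^ 2) * ‖mB B y‖ ^ 2 := by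
            rw [Finset.sum_mul]
            refine Finset.sum_congr rfl fun i hi => ?_
            rw [← (Finset.mem_filter.1 hi).2, mB_fract, nu, norm_mul, RCLike.norm_conj, mul_pow]
        _ ≤ 1 * ‖mB B y‖ ^ 2 := by
            gcongr
            -- All digits leading from s into the class y satisfy l_i ∈ s - Ry + Rℤ.
            refine sum_norm_sq_residue_le_one hR hB hν _ (s - R * y) fun i hi => ?_
            refine ⟨-⌊g R l i s⌋, ?_⟩
            have h2 := (Finset.mem_filter.1 hi).2
            have h3 := Int.fract_add_floor (g R l i s)
            have h4 := add_mul_g (l := l) hR i s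
            rw [h2] at h3
            rw [← h3] at h4
            push_cast
            linarith
        _ = _ := one_mul _
    · intro i hi
      have hi' := (Finset.mem_filter.1 hi).2
      refine Finset.mem_filter.2 ⟨hmem _ (hS s hs i hi'), ?_⟩
      have h3 := Int.fract_add_floor (g R l i s)
      have h4 := add_mul_g (l := l) hR i s
      rw [Int.fract_eq_fract]
      refine ⟨-(l i) - R * ⌊g R l i s⌋, ?_⟩
      push_cast
      rw [eq_sub_of_add_eq h3, mul_sub]
      linarith
  have h1 : (M.card : ℝ) ≤ ∑ y ∈ M, ‖mB B y‖ ^ 2 := by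
    calc (M.card : ℝ) = ∑ x ∈ M, 1 := by simp
      _ ≤ ∑ x ∈ M, ∑ y ∈ M with Int.fract ((R : ℝ) * y) = x, ‖mB B y‖ ^ 2 := Finset.sum_le_sum hfib
      _ ≤ ∑ y ∈ M, ‖mB B y‖ ^ 2 := by
        simp only [Finset.sum_filter]
        rw [Finset.sum_comm]
        refine Finset.sum_le_sum fun y _ => ?_
        rw [Finset.sum_ite_eq]
        split_ifs
        · exact le_rfl
        · positivity
  have h2 : ∀ y ∈ M, ‖mB B y‖ ^ 2 ≤ 1 := fun y _ => pow_le_one₀ (norm_nonneg _) (norm_mB_le_one B y)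
  have h3 : ∑ y ∈ M, ‖mB B y‖ ^ 2 = ∑ y ∈ M, (1 : ℝ) :=
    le_antisymm (Finset.sum_le_sum h2) (by simpa using h1)
  have h4 := (Finset.sum_eq_sum_iff_of_le h2).1 h3 _ (hmem c hc)
  rw [mB_fract] at h4
  refine isDual_of_one_le_norm_mB hB ?_
  nlinarith [norm_nonneg (mB B c)]

/-! ### Minimal finite invariant sets -/

theorem exists_nu_ne_zero (hν : ∀ t, ∑ i, ‖nu R B l α i t‖ ^ 2 = 1) (t : ℝ) :
    ∃ i, nu R B l α i t ≠ 0 := by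
  by_contra! h
  have := hν t
  simp [h] at this

namespace IsMinimalFiniteInvariantSet

variable {S S' : Set ℝ}

theorem nonempty (hS : IsMinimalFiniteInvariantSet R B l α S) : S.Nonempty := hS.2.prop.1

theorem invariant (hS : IsMinimalFiniteInvariantSet R B l α S) : IsInvariantSet R B l α S :=
  hS.2.prop.2

theorem subset_of_invariant (hS : IsMinimalFiniteInvariantSet R B l α S) {T : Set ℝ} (hT : T ⊆ S)
    (hne : T.Nonempty) (hinv : IsInvariantSet R B l α T) : S ⊆ T :=
  hS.2.le_of_le ⟨hne, hinv⟩ hT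

theorem isDual (hS : IsMinimalFiniteInvariantSet R B l α S) (hR : R ≠ 0) (hB : 0 ∈ B)
    (hν : ∀ t, ∑ i, ‖nu R B l α i t‖ ^ 2 = 1) {c : ℝ} (hc : c ∈ S) : IsDual B c :=
  isDual_of_mem_finite_invariant hR hB hν hS.1 hS.invariant hc

theorem eq_of_mem (hS : IsMinimalFiniteInvariantSet R B l α S)
    (hS' : IsMinimalFiniteInvariantSet R B l α S') {x : ℝ} (hx : x ∈ S) (hx' : x ∈ S') :
    S = S' := by
  have hinv : IsInvariantSet R B l α (S ∩ S') := fun t ht i hi =>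
    ⟨hS.invariant t ht.1 i hi, hS'.invariant t ht.2 i hi⟩
  exact Set.Subset.antisymm
    ((hS.subset_of_invariant Set.inter_subset_left ⟨x, hx, hx'⟩ hinv).trans Set.inter_subset_right)
    ((hS'.subset_of_invariant Set.inter_subset_right ⟨x, hx, hx'⟩ hinv).trans Set.inter_subset_left)

/-- The points of S with a predecessor in S form a nonempty invariant subset, which is all of S by
minimality. -/
theorem exists_predecessor (hS : IsMinimalFiniteInvariantSet R B l α S)
    (hν : ∀ t, ∑ i, ‖nu R B l α i t‖ ^ 2 = 1) {c : ℝ} (hc : c ∈ S) :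
    ∃ x ∈ S, ∃ i, nu R B l α i x ≠ 0 ∧ g R l i x = c := by
  refine hS.subset_of_invariant (T := {c | ∃ x ∈ S, ∃ i, nu R B l α i x ≠ 0 ∧ g R l i x = c})
    ?_ ?_ ?_ hc
  · rintro _ ⟨x, hx, i, hi, rfl⟩; exact hS.invariant x hx i hi
  · obtain ⟨x, hx⟩ := hS.nonempty
    obtain ⟨i, hi⟩ := exists_nu_ne_zero hν x
    exact ⟨_, x, hx, i, hi, rfl⟩
  · rintro _ ⟨x, hx, i, hi, rfl⟩ j hj
    exact ⟨_, hS.invariant x hx i hi, j, hj, rfl⟩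

/-- A point y of largest modulus has a predecessor x in S, so |R||y| ≤ |x| + L ≤ |y| + L, and |R| ≥
2. -/
theorem abs_le (hS : IsMinimalFiniteInvariantSet R B l α S) (hR : 1 < |R|)
    (hν : ∀ t, ∑ i, ‖nu R B l α i t‖ ^ 2 = 1) {L : ℝ} (hL : ∀ i, |(l i : ℝ)| ≤ L) {c : ℝ}
    (hc : c ∈ S) : |c| ≤ L := by
  obtain ⟨y, hy, hmax⟩ := hS.1.exists_maximalFor (fun x => |x|) S hS.nonempty
  have hmax' : ∀ x ∈ S, |x| ≤ |y| := fun x hx => by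
    by_contra! h
    exact absurd (hmax hx h.le) (not_le.2 h)
  obtain ⟨x, hx, i, -, rfl⟩ := hS.exists_predecessor hν hy
  refine (hmax' c hc).trans ?_
  have hR2 : (2 : ℝ) ≤ |(R : ℝ)| := by exact_mod_cast hR
  have h1 := hmax' x hx
  have h2 := add_mul_g (l := l) (R := R) (by rintro rfl; simp at hR) i x
  have h3 : |(R : ℝ)| * |g R l i x| ≤ |x| + L := by
    rw [← abs_mul, show (R : ℝ) * g R l i x = x - l i by linarith]
    exact (abs_sub _ _).trans (by linarith [hL i])
  nlinarith [abs_nonneg (g R l i x)]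

end IsMinimalFiniteInvariantSet

theorem exists_minimal_subset {Z : Set ℝ} (hfin : Z.Finite) (hne : Z.Nonempty)
    (hZ : IsInvariantSet R B l α Z) : ∃ S ⊆ Z, IsMinimalFiniteInvariantSet R B l α S := by
  have hF : {T : Set ℝ | T ⊆ Z ∧ T.Nonempty ∧ IsInvariantSet R B l α T}.Finite :=
    hfin.finite_subsets.subset fun T hT => hT.1
  obtain ⟨S, hS⟩ := hF.exists_minimal ⟨Z, subset_rfl, hne, hZ⟩
  refine ⟨S, hS.prop.1, hfin.subset hS.prop.1, hS.prop.2, fun T hT hTS => ?_⟩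
  exact hS.le_of_le ⟨hTS.trans hS.prop.1, hT⟩ hTS

/-- The transition 0 → 0 by the digit 0 already has probability 1. This guarantees that some minimal
set exists, which the maximum principle needs. -/
theorem isMinimal_singleton_zero [NeZero m] (hB : 0 ∈ B) (hl : l 0 = 0) (hα : α 0 = 1)
    (hν : ∀ t, ∑ i, ‖nu R B l α i t‖ ^ 2 = 1) :
    IsMinimalFiniteInvariantSet R B l α {0} := by
  classical
  have hg : g R l 0 0 = 0 := by simp [g, hl]
  have h0 : nu R B l α 0 0 = 1 := by
    rw [nu_of_isDual_g hB (by rw [hg]; simpa using isDual_intCast (B := B) 0), hα, map_one]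
  refine ⟨Set.finite_singleton 0, ⟨Set.singleton_nonempty 0, ?_⟩, fun T hT hT0 => ?_⟩
  · rintro _ rfl i hi
    by_cases hi0 : i = 0
    · rw [hi0, hg]; rfl
    · exfalso
      have h1 := hν 0
      rw [← Finset.add_sum_erase _ _ (Finset.mem_univ (0 : Fin m)), h0] at h1
      have h2 : ∑ x ∈ Finset.univ.erase (0 : Fin m), ‖nu R B l α x 0‖ ^ 2 = 0 := by
        simpa using h1
      have h3 := (Finset.sum_eq_zero_iff_of_nonneg fun _ _ => by positivity).1 h2 i
        (Finset.mem_erase.2 ⟨hi0, Finset.mem_univ i⟩)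
      exact hi (by simpa using h3)
  · rcases Set.subset_singleton_iff_eq.1 hT0 with h | h
    · exact absurd hT.1 (by simp [h])
    · exact h.ge

/-- All minimal sets lie in one finite set. A nonzero b ∈ B confines their points to a bounded part
of b⁻¹ℤ. If B = {0}, then m_B = 1 and the digit 0 is always admissible, so a nonzero point could be
divided by R forever, contradicting finiteness. -/
theorem finite_minimalSets [NeZero m] (hR : 1 < |R|) (hB : 0 ∈ B) (hl : l 0 = 0) (hα : α 0 = 1)
    (hν : ∀ t, ∑ i, ‖nu R B l α i t‖ ^ 2 = 1) :
    {S : Set ℝ | IsMinimalFiniteInvariantSet R B l α S}.Finite := by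
  have hR0 : R ≠ 0 := by rintro rfl; simp at hR
  obtain ⟨L, hL⟩ : ∃ L : ℕ, ∀ i, |(l i : ℝ)| ≤ L := by
    refine ⟨∑ i, (l i).natAbs, fun i => ?_⟩
    have := Finset.single_le_sum (f := fun i => (l i).natAbs) (fun _ _ => Nat.zero_le _)
      (Finset.mem_univ i)
    rw [← Int.cast_abs, Int.abs_eq_natAbs, Int.cast_natCast]
    exact_mod_cast this
  suffices h : ∃ Z : Set ℝ, Z.Finite ∧ ∀ S, IsMinimalFiniteInvariantSet R B l α S → S ⊆ Z by
    obtain ⟨Z, hZ, hsub⟩ := h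
    exact hZ.finite_subsets.subset fun S hS => hsub S hS
  by_cases hb : ∃ b ∈ B, b ≠ 0
  · obtain ⟨b, hb, hb0⟩ := hb
    have hb' : (b : ℝ) ≠ 0 := by exact_mod_cast hb0
    refine ⟨(fun k : ℤ => (k : ℝ) / b) '' Set.Icc (-(|b| * L)) (|b| * L),
      (Set.finite_Icc _ _).image _, fun S hS c hc => ?_⟩
    obtain ⟨k, hk⟩ := hS.isDual hR0 hB hν hc b hb
    refine ⟨k, ?_, by simp only; rw [← hk]; field_simp⟩
    have h1 := hS.abs_le hR hν hL hc
    have h2 : |(k : ℝ)| ≤ |(b : ℝ)| * L := by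
      rw [← hk, abs_mul]; gcongr
    rw [Set.mem_Icc, ← abs_le]
    exact_mod_cast h2
  · push Not at hb
    refine ⟨{0}, Set.finite_singleton 0, fun S hS c hc => ?_⟩
    by_contra hc0
    obtain ⟨y, ⟨hy, hy0⟩, hmin⟩ := (hS.1.inter_of_left {x | x ≠ 0}).exists_minimalFor
      (fun x => |x|) _ ⟨c, hc, hc0⟩
    have hν0 : nu R B l α 0 y ≠ 0 := by
      have hd : IsDual B (g R l 0 y) := fun b hb' => ⟨0, by simp [hb b hb']⟩
      rw [nu_of_isDual_g hB hd, hα]; simp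
    have h1 := hS.invariant y hy 0 hν0
    have h2 := add_mul_g (l := l) hR0 0 y
    rw [hl, Int.cast_zero, zero_add] at h2
    have h3 : g R l 0 y ≠ 0 := fun h => hy0 (by rw [← h2, h, mul_zero])
    have hR2 : (2 : ℝ) ≤ |(R : ℝ)| := by exact_mod_cast hR
    have h4 : |y| = |(R : ℝ)| * |g R l 0 y| := by rw [← abs_mul, h2]
    have h5 : 0 < |g R l 0 y| := abs_pos.2 h3
    have h6 := hmin ⟨h1, h3⟩ (by simp only; rw [h4]; nlinarith)
    simp only at h6
    nlinarith

end WeightedFourier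

/-! ### Recurrence and the one-step identity for the frame sum -/

namespace WeightedFourier

variable {R : ℤ} {B : Finset ℤ} {m : ℕ} {l : Fin m → ℤ} {α : Fin m → ℂ}

/-! ### Recurrence of the walk on a minimal finite invariant set -/

/-- The probability that the walk started at `x` is not at `c` at the times `1, …, n`. -/
noncomputable def avoid (R : ℤ) (B : Finset ℤ) {m : ℕ} (l : Fin m → ℤ) (α : Fin m → ℂ) (c : ℝ) :
    ℕ → ℝ → ℝ
  | 0, _ => 1
  | n + 1, x => ∑ i, ‖nu R B l α i x‖ ^ 2 *
      (open Classical in if g R l i x = c then 0 else avoid R B l α c n (g R l i x))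

theorem avoid_nonneg (c : ℝ) (n : ℕ) (x : ℝ) : 0 ≤ avoid R B l α c n x := by
  induction n generalizing x with
  | zero => exact zero_le_one
  | succ n ih =>
    refine Finset.sum_nonneg fun i _ => mul_nonneg (by positivity) ?_
    split_ifs
    · exact le_rfl
    · exact ih _

theorem avoid_succ_le (hν : ∀ t, ∑ i, ‖nu R B l α i t‖ ^ 2 = 1) (c : ℝ) (n : ℕ) (x : ℝ) :
    avoid R B l α c (n + 1) x ≤ avoid R B l α c n x := by
  induction n generalizing x with
  | zero =>
    simp only [avoid]
    refine le_of_le_of_eq (Finset.sum_le_sum fun i _ => ?_) (hν x)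
    split_ifs
    · rw [mul_zero]; positivity
    · rw [mul_one]
  | succ n ih =>
    rw [avoid, avoid]
    refine Finset.sum_le_sum fun i _ => ?_
    gcongr
    split_ifs
    · exact le_rfl
    · exact ih _

/-- The limit u of the avoidance probabilities is averaged by the walk, with value 0 substituted on
arrival at c. If its maximum over S were positive, the maximum set would be invariant, hence S, and
no transition could enter c. But c has a predecessor in S. -/
theorem tendsto_avoid {S : Set ℝ} (hS : IsMinimalFiniteInvariantSet R B l α S)
    (hν : ∀ t, ∑ i, ‖nu R B l α i t‖ ^ 2 = 1) {c x : ℝ} (hc : c ∈ S) (hx : x ∈ S) :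
    Filter.Tendsto (fun n => avoid R B l α c n x) Filter.atTop (nhds 0) := by
  classical
  have hex : ∀ y, ∃ a, Filter.Tendsto (fun n => avoid R B l α c n y) Filter.atTop (nhds a) :=
    fun y => ⟨_, tendsto_atTop_ciInf (antitone_nat_of_succ_le fun n => avoid_succ_le hν c n y)
      ⟨0, by rintro _ ⟨n, rfl⟩; exact avoid_nonneg c n y⟩⟩
  choose u hu using hex
  have hu0 : ∀ y, 0 ≤ u y := fun y => ge_of_tendsto' (hu y) fun n => avoid_nonneg c n y
  have hrec : ∀ y, u y = ∑ i, ‖nu R B l α i y‖ ^ 2 *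
      (if g R l i y = c then 0 else u (g R l i y)) := by
    intro y
    refine tendsto_nhds_unique ((hu y).comp (Filter.tendsto_add_atTop_nat 1)) ?_
    simp only [Function.comp_def, avoid]
    refine tendsto_finsetSum _ fun i _ => Filter.Tendsto.const_mul _ ?_
    split_ifs
    · exact tendsto_const_nhds
    · exact hu _
  obtain ⟨y, hy, hmax⟩ := hS.1.exists_maximalFor u S hS.nonempty
  have hmax' : ∀ z ∈ S, u z ≤ u y := fun z hz => by
    by_contra! h
    exact absurd (hmax hz h.le) (not_le.2 h)
  suffices h : u y = 0 by
    have : u x = 0 := le_antisymm (h ▸ hmax' x hx) (hu0 x)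
    exact this ▸ hu x
  by_contra hne
  have hpos : 0 < u y := lt_of_le_of_ne (hu0 y) (Ne.symm hne)
  have key : ∀ z ∈ S, u z = u y → ∀ i, nu R B l α i z ≠ 0 →
      g R l i z ≠ c ∧ u (g R l i z) = u y := by
    intro z hz hzy i hi
    have h1 : ∀ j ∈ Finset.univ, ‖nu R B l α j z‖ ^ 2 *
        (if g R l j z = c then 0 else u (g R l j z)) ≤ ‖nu R B l α j z‖ ^ 2 * u y := by
      intro j _
      by_cases hj : nu R B l α j z = 0
      · simp [hj]
      · gcongr
        split_ifs
        · exact hu0 y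
        · exact hmax' _ (hS.invariant z hz j hj)
    have h2 := (Finset.sum_eq_sum_iff_of_le h1).1
      (by rw [← hrec z, hzy, ← Finset.sum_mul, hν, one_mul]) i (Finset.mem_univ i)
    have h3 := mul_left_cancel₀ (by positivity) h2
    split_ifs at h3 with h4
    · exact absurd h3.symm hne
    · exact ⟨h4, h3⟩
  have hall : S ⊆ {z | z ∈ S ∧ u z = u y} := by
    refine hS.subset_of_invariant (fun z hz => hz.1) ⟨y, hy, rfl⟩ ?_
    rintro z ⟨hz, hzy⟩ i hi
    exact ⟨hS.invariant z hz i hi, (key z hz hzy i hi).2⟩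
  obtain ⟨z, hz, i, hi, hzc⟩ := hS.exists_predecessor hν hc
  exact (key z hz (hall hz).2 i hi).1 hzc

/-! ### First passages -/

/-- The path that starts at `x` and follows `β` is at `c` at its end, and at no intermediate time. -/
def FirstHit (R : ℤ) {m : ℕ} (l : Fin m → ℤ) (c x : ℝ) (β : List (Fin m)) : Prop :=
  β ≠ [] ∧ gWord R l β x = c ∧ ∀ k, 0 < k → k < β.length → gWord R l (β.take k) x ≠ c

theorem isCycleWord_iff {c : ℝ} {β : List (Fin m)} :
    IsCycleWord R B l α c β ↔ FirstHit R l c c β ∧ nuWord R B l α β c ≠ 0 := by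
  unfold IsCycleWord FirstHit; tauto

theorem firstHit_cons_of_eq {c x : ℝ} {i : Fin m} {ω : List (Fin m)} (h : g R l i x = c) :
    FirstHit R l c x (i :: ω) ↔ ω = [] := by
  constructor
  · rintro ⟨-, -, h3⟩
    by_contra hω
    exact h3 1 one_pos (by simpa using List.length_pos_iff.2 hω) (by simpa [gWord] using h)
  · rintro rfl
    exact ⟨by simp, h, fun k h1 h2 => by simp at h2; omega⟩

theorem firstHit_cons_of_ne {c x : ℝ} {i : Fin m} {ω : List (Fin m)} (h : g R l i x ≠ c) :
    FirstHit R l c x (i :: ω) ↔ FirstHit R l c (g R l i x) ω := by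
  constructor
  · rintro ⟨-, h2, h3⟩
    refine ⟨?_, h2, fun k hk hk' => ?_⟩
    · rintro rfl; exact h h2
    · simpa [gWord] using h3 (k + 1) (by omega) (by simpa using hk')
  · rintro ⟨h1, h2, h3⟩
    refine ⟨by simp, h2, fun k hk hk' => ?_⟩
    obtain ⟨k, rfl⟩ : ∃ j, k = j + 1 := ⟨k - 1, by omega⟩
    rcases Nat.eq_zero_or_pos k with rfl | hk0
    · simpa [gWord] using h
    · simpa [gWord] using h3 k hk0 (by simpa using hk')

theorem tsum_list {ι : Type*} [Fintype ι] (f : List ι → ENNReal) :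
    ∑' ω, f ω = f [] + ∑ i, ∑' ω, f (i :: ω) := by
  let e : Unit ⊕ (ι × List ι) ≃ List ι :=
    { toFun := Sum.elim (fun _ => []) fun p => p.1 :: p.2
      invFun := fun ω => match ω with
        | [] => Sum.inl ()
        | i :: ω => Sum.inr (i, ω)
      left_inv := by rintro (_ | _) <;> rfl
      right_inv := by rintro (_ | _) <;> rfl }
  rw [← e.tsum_eq f, ENNReal.summable.tsum_sum ENNReal.summable, tsum_fintype]
  have h : ∑' p, f (e (Sum.inr p)) = ∑ i, ∑' ω, f (i :: ω) := by
    rw [← tsum_fintype (L := .unconditional ι)]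
    exact ENNReal.tsum_prod (f := fun i ω => f (i :: ω))
  rw [h]
  simp [e]

open Classical in
-- Within n steps the walk either hits c for a first time or avoids it; the induction conditions on
-- the first letter.
theorem tsum_firstHit_add_avoid (hν : ∀ t, ∑ i, ‖nu R B l α i t‖ ^ 2 = 1) (c : ℝ) (n : ℕ)
    (x : ℝ) :
    (∑' β : List (Fin m), if β.length ≤ n ∧ FirstHit R l c x β then
      ENNReal.ofReal (‖nuWord R B l α β x‖ ^ 2) else 0) +
      ENNReal.ofReal (avoid R B l α c n x) = 1 := by
  induction n generalizing x with
  | zero =>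
    have h : ∀ β : List (Fin m), (if β.length ≤ 0 ∧ FirstHit R l c x β then
      ENNReal.ofReal (‖nuWord R B l α β x‖ ^ 2) else 0) = 0 := by
      intro β
      rw [if_neg]
      rintro ⟨h1, h2⟩
      exact h2.1 (List.length_eq_zero_iff.1 (Nat.le_zero.1 h1))
    rw [ENNReal.tsum_eq_zero.2 h, avoid]; simp
  | succ n ih =>
    rw [tsum_list, if_neg (fun h => h.2.1 rfl), zero_add, avoid,
      ENNReal.ofReal_sum_of_nonneg (fun i _ => mul_nonneg (by positivity) (by
        split_ifs
        · exact le_rfl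
        · exact avoid_nonneg _ _ _)), ← Finset.sum_add_distrib]
    have hone : ∑ i, ENNReal.ofReal (‖nu R B l α i x‖ ^ 2) = 1 := by
      rw [← ENNReal.ofReal_sum_of_nonneg fun i _ => by positivity, hν, ENNReal.ofReal_one]
    rw [← hone]
    refine Finset.sum_congr rfl fun i _ => ?_
    have hmul : ∀ ω : List (Fin m), ENNReal.ofReal (‖nuWord R B l α (i :: ω) x‖ ^ 2) =
        ENNReal.ofReal (‖nu R B l α i x‖ ^ 2) *
          ENNReal.ofReal (‖nuWord R B l α ω (g R l i x)‖ ^ 2) := fun ω => by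
      rw [nuWord, norm_mul, mul_pow, ENNReal.ofReal_mul (by positivity)]
    simp only [hmul, List.length_cons, Nat.add_le_add_iff_right]
    by_cases h : g R l i x = c
    · simp only [firstHit_cons_of_eq h, if_pos h, mul_zero, ENNReal.ofReal_zero, add_zero]
      rw [tsum_eq_single []]
      · simp [nuWord]
      · intro ω hω; simp [hω]
    · simp only [firstHit_cons_of_ne h, if_neg h]
      rw [ENNReal.ofReal_mul (by positivity)]
      conv_rhs => rw [← mul_one (ENNReal.ofReal _), ← ih (g R l i x), mul_add,
        ← ENNReal.tsum_mul_left]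
      simp only [mul_ite, mul_zero]

/-! ### Words that do not end in a cycle word -/

theorem nil_mem_Omega0 (c : ℝ) : [] ∈ Omega0 R B l α c := by
  rintro ⟨β, h1, h2⟩
  exact h1.1 (List.suffix_nil.1 h2)

theorem cons_mem_Omega0_iff {c : ℝ} {i : Fin m} {ω : List (Fin m)} :
    i :: ω ∈ Omega0 R B l α c ↔ ω ∈ Omega0 R B l α c ∧ ¬ IsCycleWord R B l α c (i :: ω) := by
  constructor
  · intro h
    exact ⟨fun ⟨β, h1, h2⟩ => h ⟨β, h1, h2.trans (List.suffix_cons i ω)⟩,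
      fun h1 => h ⟨_, h1, List.suffix_rfl⟩⟩
  · rintro ⟨h1, h2⟩ ⟨β, h3, h4⟩
    rcases List.suffix_cons_iff.1 h4 with rfl | h5
    · exact h2 h3
    · exact h1 ⟨β, h3, h5⟩

/-- If the tail ended in a cycle word β, injectivity of g_β would place the path at c when β begins,
an intermediate time. Thus every cycle word arises by prepending a letter to a word of Ω_c^{(0)}. -/
theorem IsCycleWord.tail_mem_Omega0 (hR : R ≠ 0) {c : ℝ} {i : Fin m} {ω : List (Fin m)}
    (h : IsCycleWord R B l α c (i :: ω)) : ω ∈ Omega0 R B l α c := by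
  rintro ⟨β, hβ, γ, rfl⟩
  have h1 := h.2.1
  rw [← List.cons_append, gWord_append] at h1
  have h2 : gWord R l (i :: γ) c = c := gWord_injective hR β (h1.trans hβ.2.1.symm)
  refine h.2.2.1 (γ.length + 1) (by omega) ?_ ?_
  · have := List.length_pos_iff.2 hβ.1
    simp only [List.length_cons, List.length_append]
    omega
  · simpa using h2

/-! ### The frame sum of one minimal set -/

variable {μ : Measure ℝ} [IsProbabilityMeasure μ]

open Classical in
/-- The sum of the squared moduli of the frame coefficients of `v` over the words of length at most
`n` in `Ω_c^{(0)}`. -/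
noncomputable def frameSum (R : ℤ) (B : Finset ℤ) {m : ℕ} (l : Fin m → ℤ) (α : Fin m → ℂ) (c : ℝ)
    (n : ℕ) (v : Lp ℂ 2 μ) : ENNReal :=
  ∑' ω : List (Fin m), if ω.length ≤ n ∧ ω ∈ Omega0 R B l α c then
    ENNReal.ofReal (‖inner ℂ (weightedExp μ R l α ω c) v‖ ^ 2) else 0

/-- The properties of the family of operators `T_i = V_i^*` with `V_i e_c = α_i e_{l_i + R c}` for `c`
dual to `B`. -/
structure IsTransfer (R : ℤ) (B : Finset ℤ) {m : ℕ} (l : Fin m → ℤ) (α : Fin m → ℂ)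
    (T : Fin m → Lp ℂ 2 μ → Lp ℂ 2 μ) : Prop where
  norm_sq : ∀ v, ∑ i, ‖T i v‖ ^ 2 = ‖v‖ ^ 2
  inner_exp : ∀ i c v, IsDual B c → inner ℂ (expLp μ c) (T i v) =
    (starRingEnd ℂ) (α i) * inner ℂ (expLp μ (l i + R * c)) v
  apply_exp : ∀ i t, T i (expLp μ t) = nu R B l α i t • expLp μ (g R l i t)

variable {T : Fin m → Lp ℂ 2 μ → Lp ℂ 2 μ}

theorem IsTransfer.sum_norm_sq_nu (hT : IsTransfer R B l α T) (t : ℝ) :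
    ∑ i, ‖nu R B l α i t‖ ^ 2 = 1 := by
  have := hT.norm_sq (expLp μ t)
  simpa [hT.apply_exp, norm_smul, norm_expLp] using this

theorem IsTransfer.norm_inner_exp_sq (hT : IsTransfer R B l α T) (i : Fin m) {c : ℝ}
    (hc : IsDual B c) (v : Lp ℂ 2 μ) : ‖inner ℂ (expLp μ c) (T i v)‖ ^ 2 =
      ‖α i‖ ^ 2 * ‖inner ℂ (expLp μ (l i + R * c)) v‖ ^ 2 := by
  rw [hT.inner_exp i c v hc, norm_mul, RCLike.norm_conj, mul_pow]

theorem IsTransfer.norm_inner_weightedExp (hT : IsTransfer R B l α T) {c : ℝ} (hc : IsDual B c)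
    (i : Fin m) (ω : List (Fin m)) (v : Lp ℂ 2 μ) :
    ‖inner ℂ (weightedExp μ R l α ω c) (T i v)‖ ^ 2 =
      ‖inner ℂ (weightedExp μ R l α (i :: ω) c) v‖ ^ 2 := by
  simp only [weightedExp, inner_smul_left, norm_mul, RCLike.norm_conj, mul_pow, List.map_cons,
    List.prod_cons]
  rw [hT.norm_inner_exp_sq i (hc.wordFreq ω), wordFreq_cons]
  ring

/-- Along a closed path the frequency is c itself, and the product of the α's has modulus |ν_β(c)|.
-/
theorem norm_inner_weightedExp_of_gWord (hR : R ≠ 0) (hB : 0 ∈ B) {c : ℝ} (hc : IsDual B c)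
    {β : List (Fin m)} (hβ : gWord R l β c = c) (v : Lp ℂ 2 μ) :
    ‖inner ℂ (weightedExp μ R l α β c) v‖ ^ 2 =
      ‖nuWord R B l α β c‖ ^ 2 * ‖inner ℂ (expLp μ c) v‖ ^ 2 := by
  have h1 := wordFreq_eq_of_gWord hR hβ
  have h2 := nuWord_wordFreq (l := l) (α := α) hR hB hc β
  rw [h1] at h2
  rw [h2, weightedExp, h1, inner_smul_left, norm_mul, mul_pow]

theorem norm_inner_weightedExp_nil (c : ℝ) (v : Lp ℂ 2 μ) :
    ‖inner ℂ (weightedExp μ R l α [] c) v‖ ^ 2 = ‖inner ℂ (expLp μ c) v‖ ^ 2 := by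
  simp [weightedExp, wordFreq_nil]

theorem frameSum_zero (c : ℝ) (v : Lp ℂ 2 μ) :
    frameSum R B l α c 0 v = ENNReal.ofReal (‖inner ℂ (expLp μ c) v‖ ^ 2) := by
  classical
  rw [frameSum, tsum_eq_single []]
  · rw [if_pos ⟨by simp, nil_mem_Omega0 c⟩, norm_inner_weightedExp_nil]
  · intro ω hω
    rw [if_neg]
    rintro ⟨h, -⟩
    exact hω (List.length_eq_zero_iff.1 (Nat.le_zero.1 h))

theorem IsTransfer.frameSum_succ (hT : IsTransfer R B l α T) (hR : R ≠ 0) (hB : 0 ∈ B) {c : ℝ}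
    (hc : IsDual B c) (n : ℕ) (v : Lp ℂ 2 μ) :
    frameSum R B l α c (n + 1) v = ∑ i, frameSum R B l α c n (T i v) +
      ENNReal.ofReal (avoid R B l α c (n + 1) c * ‖inner ℂ (expLp μ c) v‖ ^ 2) := by
  classical
  set q : List (Fin m) → ENNReal := fun ω =>
    ENNReal.ofReal (‖inner ℂ (weightedExp μ R l α ω c) v‖ ^ 2) with hq
  set W : ENNReal := ∑' β : List (Fin m), if β.length ≤ n + 1 ∧ FirstHit R l c c β then
    ENNReal.ofReal (‖nuWord R B l α β c‖ ^ 2) else 0 with hW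
  have hWU := tsum_firstHit_add_avoid hT.sum_norm_sq_nu c (n + 1) c
  rw [← hW] at hWU
  have hq0 : q [] = ENNReal.ofReal (‖inner ℂ (expLp μ c) v‖ ^ 2) := by
    rw [hq]; simp only; rw [norm_inner_weightedExp_nil]
  have hcyc : ∑' β, (if β.length ≤ n + 1 ∧ IsCycleWord R B l α c β then q β else 0) =
      W * q [] := by
    rw [hW, ← ENNReal.tsum_mul_right]
    refine tsum_congr fun β => ?_
    rw [isCycleWord_iff]
    by_cases h1 : β.length ≤ n + 1 ∧ FirstHit R l c c β
    · have h2 : q β = ENNReal.ofReal (‖nuWord R B l α β c‖ ^ 2) * q [] := by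
        rw [hq0, ← ENNReal.ofReal_mul (by positivity), hq]
        simp only
        rw [norm_inner_weightedExp_of_gWord hR hB hc h1.2.2.1]
      by_cases h3 : nuWord R B l α β c = 0
      · simp [h3]
      · rw [if_pos ⟨h1.1, h1.2, h3⟩, if_pos h1, h2]
    · rw [if_neg (fun h => h1 ⟨h.1, h.2.1⟩), if_neg h1, zero_mul]
  -- Prepending a letter to the words of Ω_c^{(0)} of length at most n yields the nonempty words of
  -- Ω_c^{(0)} together with the cycle words, both of length at most n + 1. The term `q []` accounts
  -- for the empty word.
  have hsplit : ∑ i, frameSum R B l α c n (T i v) + q [] =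
      frameSum R B l α c (n + 1) v + W * q [] := by
    rw [← hcyc, tsum_list fun β => if β.length ≤ n + 1 ∧ IsCycleWord R B l α c β then q β else 0,
      if_neg (fun h => h.2.1 rfl), zero_add, frameSum, tsum_list,
      if_pos ⟨by simp, nil_mem_Omega0 c⟩, add_comm, add_assoc, ← Finset.sum_add_distrib]
    congr 1
    refine Finset.sum_congr rfl fun i _ => ?_
    rw [← ENNReal.tsum_add, frameSum]
    refine tsum_congr fun ω => ?_
    rw [hT.norm_inner_weightedExp hc]
    simp only [List.length_cons, Nat.add_le_add_iff_right, cons_mem_Omega0_iff]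
    have htail := IsCycleWord.tail_mem_Omega0 (B := B) (l := l) (α := α) hR (c := c) (i := i)
      (ω := ω)
    by_cases h1 : ω.length ≤ n <;> by_cases h2 : ω ∈ Omega0 R B l α c <;>
      by_cases h3 : IsCycleWord R B l α c (i :: ω) <;> simp_all
  rw [ENNReal.ofReal_mul (avoid_nonneg _ _ _), ← hq0]
  have hfin : W * q [] ≠ ⊤ := by
    refine ENNReal.mul_ne_top (fun h => ?_) ENNReal.ofReal_ne_top
    rw [h, top_add] at hWU
    exact ENNReal.top_ne_one hWU
  -- The empty word outweighs the cycle words exactly by the probability of not having returned to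
  -- c.
  have h4 : q [] = ENNReal.ofReal (avoid R B l α c (n + 1) c) * q [] + W * q [] := by
    rw [← add_mul, add_comm, hWU, one_mul]
  refine ((ENNReal.add_left_inj hfin).1 ?_).symm
  rw [← hsplit, add_assoc, ← h4]

end WeightedFourier

/-! ### From the Bessel inequality to the Parseval identity -/

namespace WeightedFourier

variable {R : ℤ} {B : Finset ℤ} {m : ℕ} {l : Fin m → ℤ} {α : Fin m → ℂ}
variable {μ : Measure ℝ} [IsProbabilityMeasure μ] {T : Fin m → Lp ℂ 2 μ → Lp ℂ 2 μ}

/-! ### The Bessel inequality -/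

/-- Take a closest pair a ≠ b with nonorthogonal exponentials. If ν_i(a) ≠ 0, then ⟨e_a, e_b⟩ is, up
to a nonzero factor, ν_i(b) ⟨e_{g_i(a)}, e_{g_i(b)}⟩. So the images again lie in Z and are
nonorthogonal, at distance smaller by the factor |R|. -/
theorem IsTransfer.inner_expLp_eq_zero (hT : IsTransfer R B l α T) (hR : 1 < |R|) (hB : 0 ∈ B)
    {Z : Set ℝ} (hfin : Z.Finite) (hZ : IsInvariantSet R B l α Z) {x y : ℝ} (hx : x ∈ Z)
    (hy : y ∈ Z) (hxy : x ≠ y) : inner ℂ (expLp μ x) (expLp μ y) = 0 := by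
  have hR0 : R ≠ 0 := by rintro rfl; simp at hR
  by_contra hne
  have hP : {p : ℝ × ℝ | p ∈ Z ×ˢ Z ∧ p.1 ≠ p.2 ∧
      inner ℂ (expLp μ p.1) (expLp μ p.2) ≠ 0}.Finite :=
    (hfin.prod hfin).subset fun p hp => hp.1
  obtain ⟨⟨a, b⟩, ⟨⟨ha, hb⟩, hab, hin⟩, hmin⟩ :=
    hP.exists_minimalFor (fun p => |p.1 - p.2|) _ ⟨(x, y), ⟨hx, hy⟩, hxy, hne⟩
  simp only at ha hb hab hin
  obtain ⟨i, hi⟩ := exists_nu_ne_zero hT.sum_norm_sq_nu a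
  have hga := hZ a ha i hi
  have hαi : α i ≠ 0 := fun h => hi (by simp [nu, h])
  have h1 := hT.inner_exp i (g R l i a) (expLp μ b)
    (isDual_of_mem_finite_invariant hR0 hB hT.sum_norm_sq_nu hfin hZ hga)
  rw [add_mul_g hR0, hT.apply_exp, inner_smul_right] at h1
  have h2 : nu R B l α i b * inner ℂ (expLp μ (g R l i a)) (expLp μ (g R l i b)) ≠ 0 := by
    rw [h1]; simp [hαi, hin]
  have hgb := hZ b hb i (left_ne_zero_of_mul h2)
  have hgab : g R l i a ≠ g R l i b := fun h => hab (g_injective hR0 i h)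
  have h3 : a - b = R * (g R l i a - g R l i b) := by
    have := add_mul_g (l := l) hR0 i a
    have := add_mul_g (l := l) hR0 i b
    linarith
  have h4 : |a - b| = |(R : ℝ)| * |g R l i a - g R l i b| := by rw [h3, abs_mul]
  have hR2 : (2 : ℝ) ≤ |(R : ℝ)| := by exact_mod_cast hR
  have h5 : 0 < |g R l i a - g R l i b| := abs_pos.2 (sub_ne_zero.2 hgab)
  have h6 := hmin (j := (g R l i a, g R l i b)) ⟨⟨hga, hgb⟩, hgab, right_ne_zero_of_mul h2⟩
    (by simp only; rw [h4]; nlinarith)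
  simp only at h6
  nlinarith

/-- Substitute x = g_i(y), which is injective in y. For admissible transitions |ν_i(y)| = |α_i|, so
the weight is absorbed into ⟨e_x, T_i v⟩; paths arriving at c drop out. -/
theorem IsTransfer.sum_avoid_le (hT : IsTransfer R B l α T) (hR : R ≠ 0) (hB : 0 ∈ B)
    {S : Set ℝ} (hS : IsMinimalFiniteInvariantSet R B l α S) (c : ℝ) (n : ℕ)
    (v : Lp ℂ 2 μ) :
    ∑ y ∈ hS.1.toFinset, avoid R B l α c (n + 1) y * ‖inner ℂ (expLp μ y) v‖ ^ 2 ≤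
      ∑ i, ∑ x ∈ hS.1.toFinset.erase c,
        avoid R B l α c n x * ‖inner ℂ (expLp μ x) (T i v)‖ ^ 2 := by
  classical
  simp only [avoid, Finset.sum_mul]
  rw [Finset.sum_comm]
  refine Finset.sum_le_sum fun i _ => ?_
  set S' := hS.1.toFinset.filter fun y => nu R B l α i y ≠ 0 ∧ g R l i y ≠ c with hS'
  have h1 : ∑ y ∈ hS.1.toFinset, ‖nu R B l α i y‖ ^ 2 *
      (if g R l i y = c then 0 else avoid R B l α c n (g R l i y)) *
        ‖inner ℂ (expLp μ y) v‖ ^ 2 =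
      ∑ y ∈ S', avoid R B l α c n (g R l i y) * ‖inner ℂ (expLp μ (g R l i y)) (T i v)‖ ^ 2 := by
    rw [hS', Finset.sum_filter]
    refine Finset.sum_congr rfl fun y hy => ?_
    by_cases h0 : nu R B l α i y = 0
    · simp [h0]
    by_cases h2 : g R l i y = c
    · simp [h2]
    have hd := hS.isDual hR hB hT.sum_norm_sq_nu (hS.invariant y (hS.1.mem_toFinset.1 hy) i h0)
    rw [if_neg h2, if_pos ⟨h0, h2⟩, hT.norm_inner_exp_sq i hd, add_mul_g hR,
      nu_of_isDual_g hB hd, RCLike.norm_conj]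
    ring
  rw [h1, ← Finset.sum_image (s := S') (g := g R l i)
    (f := fun x => avoid R B l α c n x * ‖inner ℂ (expLp μ x) (T i v)‖ ^ 2)
    (fun _ _ _ _ h => g_injective hR i h)]
  refine Finset.sum_le_sum_of_subset_of_nonneg ?_ fun x _ _ =>
    mul_nonneg (avoid_nonneg _ _ _) (by positivity)
  intro x hx
  obtain ⟨y, hy, rfl⟩ := Finset.mem_image.1 hx
  obtain ⟨hy1, hy2, hy3⟩ := Finset.mem_filter.1 hy
  exact Finset.mem_erase.2
    ⟨hy3, hS.1.mem_toFinset.2 (hS.invariant y (hS.1.mem_toFinset.1 hy1) i hy2)⟩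

/-- The error term of `frameSum_succ` is the x = c term of the avoidance sum over S. Carrying the
terms with x ≠ c along makes the estimate close up under induction. -/
theorem IsTransfer.frameSum_add_succ_le (hT : IsTransfer R B l α T) (hR : R ≠ 0) (hB : 0 ∈ B)
    {S : Set ℝ} (hS : IsMinimalFiniteInvariantSet R B l α S) {c : ℝ} (hc : c ∈ S) (n : ℕ)
    (v : Lp ℂ 2 μ) :
    frameSum R B l α c (n + 1) v + ENNReal.ofReal (∑ x ∈ hS.1.toFinset.erase c,
        avoid R B l α c (n + 1) x * ‖inner ℂ (expLp μ x) v‖ ^ 2) ≤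
      ∑ i, (frameSum R B l α c n (T i v) + ENNReal.ofReal (∑ x ∈ hS.1.toFinset.erase c,
        avoid R B l α c n x * ‖inner ℂ (expLp μ x) (T i v)‖ ^ 2)) := by
  have hnn : ∀ k (w : Lp ℂ 2 μ) x, 0 ≤ avoid R B l α c k x * ‖inner ℂ (expLp μ x) w‖ ^ 2 :=
    fun k w x => mul_nonneg (avoid_nonneg _ _ _) (by positivity)
  rw [hT.frameSum_succ hR hB (hS.isDual hR hB hT.sum_norm_sq_nu hc), add_assoc,
    ← ENNReal.ofReal_add (hnn _ _ _) (Finset.sum_nonneg fun x _ => hnn _ _ x),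
    Finset.add_sum_erase _ (fun x => avoid R B l α c (n + 1) x * ‖inner ℂ (expLp μ x) v‖ ^ 2)
      (hS.1.mem_toFinset.2 hc), Finset.sum_add_distrib,
    ← ENNReal.ofReal_sum_of_nonneg fun i _ => Finset.sum_nonneg fun x _ => hnn _ _ x]
  gcongr
  exact hT.sum_avoid_le hR hB hS c n v

theorem IsTransfer.sum_sum_norm_inner_le (hT : IsTransfer R B l α T) (hR : 1 < |R|) (hB : 0 ∈ B)
    [Fintype {S : Set ℝ // IsMinimalFiniteInvariantSet R B l α S}] (v : Lp ℂ 2 μ) :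
    ∑ S : {S : Set ℝ // IsMinimalFiniteInvariantSet R B l α S},
      ∑ x ∈ S.2.1.toFinset, ‖inner ℂ (expLp μ x) v‖ ^ 2 ≤ ‖v‖ ^ 2 := by
  classical
  rw [← Finset.sum_biUnion]
  · set Z := (Finset.univ : Finset {S : Set ℝ // IsMinimalFiniteInvariantSet R B l α S}).biUnion
      fun S => S.2.1.toFinset with hZ
    have hinv : IsInvariantSet R B l α (Z : Set ℝ) := by
      intro t ht i hi
      simp only [hZ, Finset.coe_biUnion, Set.mem_iUnion, Finset.mem_coe, Set.Finite.mem_toFinset]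
        at ht ⊢
      obtain ⟨S, hS, htS⟩ := ht
      exact ⟨S, hS, S.2.invariant t htS i hi⟩
    have horth : Orthonormal ℂ fun x : Z => expLp μ x :=
      ⟨fun x => norm_expLp _, fun x y hxy => hT.inner_expLp_eq_zero hR hB Z.finite_toSet hinv
        x.2 y.2 fun h => hxy (Subtype.ext h)⟩
    rw [← Finset.sum_coe_sort Z]
    exact horth.sum_inner_products_le v (s := Finset.univ)
  · intro S _ S' _ hne
    rw [Function.onFun, Finset.disjoint_left]
    intro x hx hx'
    exact hne (Subtype.ext (S.2.eq_of_mem S'.2 (S.2.1.mem_toFinset.1 hx)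
      (S'.2.1.mem_toFinset.1 hx')))

theorem IsTransfer.sum_frameSum_le (hT : IsTransfer R B l α T) (hR : 1 < |R|) (hB : 0 ∈ B)
    [Fintype {S : Set ℝ // IsMinimalFiniteInvariantSet R B l α S}]
    (c : {S : Set ℝ // IsMinimalFiniteInvariantSet R B l α S} → ℝ) (hc : ∀ S, c S ∈ S.1)
    (n : ℕ) (v : Lp ℂ 2 μ) :
    ∑ S, frameSum R B l α (c S) n v ≤ ENNReal.ofReal (‖v‖ ^ 2) := by
  have hR0 : R ≠ 0 := by rintro rfl; simp at hR
  -- The bound is strengthened by the avoidance terms. At n = 0 they complete the sum to all points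
  -- of all minimal sets, where Bessel's inequality for orthonormal exponentials applies.
  suffices h : ∑ S, (frameSum R B l α (c S) n v + ENNReal.ofReal (∑ x ∈ S.2.1.toFinset.erase (c S),
      avoid R B l α (c S) n x * ‖inner ℂ (expLp μ x) v‖ ^ 2)) ≤ ENNReal.ofReal (‖v‖ ^ 2) from
    (Finset.sum_le_sum fun S _ => le_self_add).trans h
  induction n generalizing v with
  | zero =>
    refine le_trans (le_of_eq ?_) (ENNReal.ofReal_le_ofReal (hT.sum_sum_norm_inner_le hR hB v))
    rw [ENNReal.ofReal_sum_of_nonneg fun S _ => Finset.sum_nonneg fun x _ => by positivity]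
    refine Finset.sum_congr rfl fun S _ => ?_
    simp only [avoid, one_mul]
    rw [frameSum_zero, ← ENNReal.ofReal_add (by positivity)
      (Finset.sum_nonneg fun x _ => by positivity),
      Finset.add_sum_erase _ (fun x => ‖inner ℂ (expLp μ x) v‖ ^ 2)
        (S.2.1.mem_toFinset.2 (hc S))]
  | succ n ih =>
    calc _ ≤ ∑ S, ∑ i, _ :=
          Finset.sum_le_sum fun S _ => hT.frameSum_add_succ_le hR0 hB S.2 (hc S) n v
      _ = ∑ i, ∑ S, _ := Finset.sum_comm
      _ ≤ ∑ i, ENNReal.ofReal (‖T i v‖ ^ 2) := Finset.sum_le_sum fun i _ => ih (T i v)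
      _ = ENNReal.ofReal (‖v‖ ^ 2) := by
          rw [← ENNReal.ofReal_sum_of_nonneg fun i _ => by positivity, hT.norm_sq]

theorem tendsto_frameSum (c : ℝ) (v : Lp ℂ 2 μ) :
    Filter.Tendsto (fun n => frameSum R B l α c n v) Filter.atTop
      (nhds (∑' ω : Omega0 R B l α c,
        ENNReal.ofReal (‖inner ℂ (weightedExp μ R l α ω.1 c) v‖ ^ 2))) := by
  classical
  rw [tsum_subtype (Omega0 R B l α c) fun ω =>
    ENNReal.ofReal (‖inner ℂ (weightedExp μ R l α ω c) v‖ ^ 2)]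
  have hmono : Monotone fun n => frameSum R B l α c n v := by
    intro n k hnk
    refine ENNReal.tsum_le_tsum fun ω => ?_
    by_cases h : ω.length ≤ n ∧ ω ∈ Omega0 R B l α c
    · rw [if_pos h, if_pos ⟨h.1.trans hnk, h.2⟩]
    · rw [if_neg h]; exact zero_le
  convert tendsto_atTop_iSup hmono using 2
  refine le_antisymm ?_ (iSup_le fun n => ENNReal.tsum_le_tsum fun ω => ?_)
  · rw [ENNReal.tsum_eq_iSup_sum]
    refine iSup_le fun s => le_iSup_of_le (s.sup List.length) ?_
    rw [frameSum]
    refine le_trans (Finset.sum_le_sum fun ω hω => ?_) (ENNReal.sum_le_tsum s)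
    have h1 : ω.length ≤ s.sup List.length := Finset.le_sup (f := List.length) hω
    by_cases h : ω ∈ Omega0 R B l α c <;> simp [h, h1]
  · by_cases h : ω ∈ Omega0 R B l α c <;> simp [h]
    split_ifs <;> simp

/-- The limit of `frameSum_succ`: recurrence at c kills the error term. -/
theorem IsTransfer.tsum_frame_eq (hT : IsTransfer R B l α T) (hR : R ≠ 0) (hB : 0 ∈ B)
    {S : Set ℝ} (hS : IsMinimalFiniteInvariantSet R B l α S) {c : ℝ} (hc : c ∈ S)
    (v : Lp ℂ 2 μ) :
    ∑' ω : Omega0 R B l α c, ENNReal.ofReal (‖inner ℂ (weightedExp μ R l α ω.1 c) v‖ ^ 2) =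
      ∑ i, ∑' ω : Omega0 R B l α c,
        ENNReal.ofReal (‖inner ℂ (weightedExp μ R l α ω.1 c) (T i v)‖ ^ 2) := by
  have h1 := (tendsto_frameSum (R := R) (B := B) (l := l) (α := α) c v).comp
    (Filter.tendsto_add_atTop_nat 1)
  refine tendsto_nhds_unique h1 ?_
  simp only [Function.comp_def,
    hT.frameSum_succ hR hB (hS.isDual hR hB hT.sum_norm_sq_nu hc)]
  have h2 : Filter.Tendsto (fun n => ENNReal.ofReal
      (avoid R B l α c (n + 1) c * ‖inner ℂ (expLp μ c) v‖ ^ 2)) Filter.atTop (nhds 0) := by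
    have := ((tendsto_avoid hS hT.sum_norm_sq_nu hc hc).comp
      (Filter.tendsto_add_atTop_nat 1)).mul_const (‖inner ℂ (expLp μ c) v‖ ^ 2)
    rw [zero_mul] at this
    simpa [Function.comp_def] using ENNReal.tendsto_ofReal this
  simpa using (tendsto_finsetSum Finset.univ fun i _ => tendsto_frameSum c (T i v)).add h2

/-! ### The analysis operator -/

theorem exists_analysis_operator {ι H : Type*} [NormedAddCommGroup H] [InnerProductSpace ℂ H]
    (f : ι → H)
    (hb : ∀ v, ∑' i, ENNReal.ofReal (‖inner ℂ (f i) v‖ ^ 2) ≤ ENNReal.ofReal (‖v‖ ^ 2)) :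
    ∃ A : H →L[ℂ] lp (fun _ : ι => ℂ) 2, (∀ v, ‖A v‖ ≤ ‖v‖) ∧
      ∀ v, HasSum (fun i => ‖inner ℂ (f i) v‖ ^ 2) (‖A v‖ ^ 2) := by
  have hsum : ∀ v, Summable fun i => ‖inner ℂ (f i) v‖ ^ 2 := fun v => by
    have h1 : ∑' i, ENNReal.ofReal (‖inner ℂ (f i) v‖ ^ 2) ≠ ⊤ :=
      ((hb v).trans_lt ENNReal.ofReal_lt_top).ne
    refine (ENNReal.summable_toReal h1).congr fun i => ?_
    rw [ENNReal.toReal_ofReal (by positivity)]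
  have hmem : ∀ v, Memℓp (fun i => (inner ℂ (f i) v : ℂ)) 2 := fun v =>
    memℓp_gen (by simpa using hsum v)
  have hnorm : ∀ v, HasSum (fun i => ‖inner ℂ (f i) v‖ ^ 2)
      (‖(⟨_, hmem v⟩ : lp (fun _ : ι => ℂ) 2)‖ ^ 2) := fun v => by
    simpa using lp.hasSum_norm (p := 2) (by norm_num) (⟨_, hmem v⟩ : lp (fun _ : ι => ℂ) 2)
  have hle : ∀ v, ‖(⟨_, hmem v⟩ : lp (fun _ : ι => ℂ) 2)‖ ≤ ‖v‖ := fun v => by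
    have h1 := hb v
    rw [← ENNReal.ofReal_tsum_of_nonneg (fun i => by positivity) (hsum v), (hnorm v).tsum_eq,
      ENNReal.ofReal_le_ofReal_iff (by positivity)] at h1
    exact (sq_le_sq₀ (norm_nonneg _) (norm_nonneg _)).1 h1
  let A₀ : H →ₗ[ℂ] lp (fun _ : ι => ℂ) 2 :=
    { toFun := fun v => ⟨_, hmem v⟩
      map_add' := fun u v => by ext i; exact inner_add_right _ _ _
      map_smul' := fun a v => by ext i; exact inner_smul_right _ _ _ }
  exact ⟨A₀.mkContinuous 1 fun v => by simpa [A₀] using hle v, hle, hnorm⟩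

/-- The vectors whose norm A preserves form a closed subspace. For sums, the parallelogram law in
both spaces fixes ‖A(u+v)‖² + ‖A(u-v)‖², and neither summand can exceed its counterpart. -/
theorem norm_eq_of_contraction {H K : Type*} [NormedAddCommGroup H] [InnerProductSpace ℂ H]
    [NormedAddCommGroup K] [InnerProductSpace ℂ K] (A : H →L[ℂ] K) (hA : ∀ v, ‖A v‖ ≤ ‖v‖)
    {s : Set H} (hs : (Submodule.span ℂ s).topologicalClosure = ⊤)
    (h : ∀ v ∈ s, ‖A v‖ = ‖v‖) (v : H) : ‖A v‖ = ‖v‖ := by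
  let M : Submodule ℂ H :=
    { carrier := {v | ‖A v‖ = ‖v‖}
      zero_mem' := by simp
      add_mem' := fun {u v} hu hv => by
        have h1 := parallelogram_law_with_norm ℂ u v
        have h2 := parallelogram_law_with_norm ℂ (A u) (A v)
        rw [← map_add, ← map_sub] at h2
        have hu' : ‖A u‖ = ‖u‖ := hu
        have hv' : ‖A v‖ = ‖v‖ := hv
        rw [hu', hv'] at h2
        have h3 := hA (u + v)
        have h4 := hA (u - v)
        refine le_antisymm h3 ?_
        have h5 := mul_self_le_mul_self (norm_nonneg _) h4
        exact abs_le_of_sq_le_sq' (by nlinarith) (norm_nonneg _) |>.2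
      smul_mem' := fun a v hv => by
        have hv' : ‖A v‖ = ‖v‖ := hv
        change ‖A (a • v)‖ = ‖a • v‖
        rw [map_smul, norm_smul, norm_smul, hv'] }
  have hclosed : IsClosed (M : Set H) := isClosed_eq (by fun_prop) (by fun_prop)
  have h1 : (Submodule.span ℂ s).topologicalClosure ≤ M :=
    Submodule.topologicalClosure_minimal _ (Submodule.span_le.2 h) hclosed
  rw [hs] at h1
  exact h1 trivial

/-! ### Harmonic functions -/

/-- Maximum principle on an interval that every g_i maps into itself: the set where d attains its
maximum is invariant. If finite, it contains a minimal set and hence a zero of d, so the maximum is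
0. If infinite, it accumulates, so the analytic function d is constant, and it has a zero. -/
theorem nonpos_of_harmonic (hR : 1 < |R|) (hν : ∀ t, ∑ i, ‖nu R B l α i t‖ ^ 2 = 1)
    {d : ℝ → ℝ} (hd : AnalyticOnNhd ℝ d Set.univ)
    (hharm : ∀ t, d t = ∑ i, ‖nu R B l α i t‖ ^ 2 * d (g R l i t))
    (hzero : ∀ S, IsMinimalFiniteInvariantSet R B l α S → ∃ x ∈ S, d x = 0)
    (hex : ∃ S, IsMinimalFiniteInvariantSet R B l α S) (t₀ : ℝ) : d t₀ ≤ 0 := by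
  have hR0 : R ≠ 0 := by rintro rfl; simp at hR
  have hR2 : (2 : ℝ) ≤ |(R : ℝ)| := by exact_mod_cast hR
  obtain ⟨C, hC0, hC⟩ : ∃ C : ℝ, |t₀| ≤ C ∧ ∀ i, |(l i : ℝ)| ≤ C :=
    ⟨|t₀| + ∑ i, |(l i : ℝ)|,
      le_add_of_nonneg_right (Finset.sum_nonneg fun _ _ => abs_nonneg _), fun i =>
      le_add_of_nonneg_of_le (abs_nonneg _) (Finset.single_le_sum (f := fun i => |(l i : ℝ)|)
        (fun _ _ => abs_nonneg _) (Finset.mem_univ i))⟩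
  have hcont : Continuous d := continuousOn_univ.1 hd.continuousOn
  have ht₀ : t₀ ∈ Set.Icc (-C) C := abs_le.1 hC0
  obtain ⟨z, hz, hmax⟩ := isCompact_Icc.exists_isMaxOn ⟨t₀, ht₀⟩ hcont.continuousOn
  have hmax' : ∀ x ∈ Set.Icc (-C) C, d x ≤ d z := fun x hx => hmax hx
  refine (hmax' t₀ ht₀).trans ?_
  have hg : ∀ x ∈ Set.Icc (-C) C, ∀ i, g R l i x ∈ Set.Icc (-C) C := by
    intro x hx i
    rw [Set.mem_Icc, ← abs_le] at hx ⊢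
    have h2 := add_mul_g (l := l) hR0 i x
    have h3 : |(R : ℝ)| * |g R l i x| ≤ |x| + C := by
      rw [← abs_mul, show (R : ℝ) * g R l i x = x - l i by linarith]
      exact (abs_sub _ _).trans (by linarith [hC i])
    nlinarith [abs_nonneg (g R l i x)]
  set Z := {x | x ∈ Set.Icc (-C) C ∧ d x = d z} with hZdef
  have hZ : IsInvariantSet R B l α Z := by
    rintro x ⟨hx, hxz⟩ i hi
    refine ⟨hg x hx i, ?_⟩
    have h1 : ∀ j ∈ Finset.univ, ‖nu R B l α j x‖ ^ 2 * d (g R l j x) ≤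
        ‖nu R B l α j x‖ ^ 2 * d z := fun j _ => by
      gcongr; exact hmax' _ (hg x hx j)
    have h2 := (Finset.sum_eq_sum_iff_of_le h1).1
      (by rw [← hharm x, hxz, ← Finset.sum_mul, hν, one_mul]) i (Finset.mem_univ i)
    exact mul_left_cancel₀ (by positivity) h2
  by_cases hfin : Z.Finite
  · obtain ⟨S, hSZ, hS⟩ := exists_minimal_subset hfin ⟨z, hz, rfl⟩ hZ
    obtain ⟨x, hx, hx0⟩ := hzero S hS
    rw [← (hSZ hx).2, hx0]
  · obtain ⟨a, -, ha⟩ := Set.Infinite.exists_accPt_of_subset_isCompact hfin isCompact_Icc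
      (fun x hx => hx.1)
    have hfreq : ∃ᶠ x in nhdsWithin a {a}ᶜ, d x = d z := by
      rw [accPt_iff_frequently_nhdsNE] at ha
      exact ha.mono fun x hx => hx.2
    have hconst := hd.eqOn_of_preconnected_of_frequently_eq (analyticOnNhd_const (v := d z))
      isPreconnected_univ (Set.mem_univ a) hfreq
    obtain ⟨S, hS⟩ := hex
    obtain ⟨x, hx, hx0⟩ := hzero S hS
    have := hconst (Set.mem_univ x)
    simp only at this
    rw [← this, hx0]

/-! ### The Parseval property -/

theorem IsTransfer.isParsevalFrame [NeZero m] (hT : IsTransfer R B l α T) (hR : 1 < |R|)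
    (hB : 0 ∈ B) (hμ : IsInvariantMeasure R B μ) (hl : l 0 = 0) (hα : α 0 = 1)
    (c : {S : Set ℝ // IsMinimalFiniteInvariantSet R B l α S} → ℝ) (hc : ∀ S, c S ∈ S.1) :
    IsParsevalFrame (fun p : (S : {S : Set ℝ // IsMinimalFiniteInvariantSet R B l α S}) ×
      Omega0 R B l α (c S) => weightedExp μ R l α p.2.1 (c p.1)) := by
  have hR0 : R ≠ 0 := by rintro rfl; simp at hR
  have hν := hT.sum_norm_sq_nu
  have : Finite {S : Set ℝ // IsMinimalFiniteInvariantSet R B l α S} :=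
    (finite_minimalSets hR hB hl hα hν).to_subtype
  have := Fintype.ofFinite {S : Set ℝ // IsMinimalFiniteInvariantSet R B l α S}
  set f : ((S : {S : Set ℝ // IsMinimalFiniteInvariantSet R B l α S}) ×
    Omega0 R B l α (c S)) → Lp ℂ 2 μ := fun p => weightedExp μ R l α p.2.1 (c p.1) with hf
  have hsigma : ∀ v, ∑' p, ENNReal.ofReal (‖inner ℂ (f p) v‖ ^ 2) =
      ∑ S, ∑' ω : Omega0 R B l α (c S),
        ENNReal.ofReal (‖inner ℂ (weightedExp μ R l α ω.1 (c S)) v‖ ^ 2) := fun v => by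
    rw [ENNReal.tsum_sigma', tsum_fintype]
  obtain ⟨A, hA, hsum⟩ := exists_analysis_operator f fun v => by
    rw [hsigma]
    exact le_of_tendsto' (tendsto_finsetSum Finset.univ fun S _ => tendsto_frameSum (c S) v)
      fun n => hT.sum_frameSum_le hR hB c hc n v
  have hAe : ∀ v, ENNReal.ofReal (‖A v‖ ^ 2) = ∑' p, ENNReal.ofReal (‖inner ℂ (f p) v‖ ^ 2) :=
    fun v => by
      rw [← (hsum v).tsum_eq, ENNReal.ofReal_tsum_of_nonneg (fun _ => by positivity)
        (hsum v).summable]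
  have hAT : ∀ v, ‖A v‖ ^ 2 = ∑ i, ‖A (T i v)‖ ^ 2 := fun v => by
    have h1 : ENNReal.ofReal (‖A v‖ ^ 2) = ENNReal.ofReal (∑ i, ‖A (T i v)‖ ^ 2) := by
      rw [ENNReal.ofReal_sum_of_nonneg fun i _ => by positivity]
      simp only [hAe, hsigma]
      rw [Finset.sum_comm]
      exact Finset.sum_congr rfl fun S _ => hT.tsum_frame_eq hR0 hB S.2 (hc S) v
    rwa [ENNReal.ofReal_eq_ofReal_iff (by positivity)
      (Finset.sum_nonneg fun _ _ => by positivity)] at h1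
  have hanalytic : AnalyticOnNhd ℝ (fun t => 1 - ‖A (expLp μ t)‖ ^ 2) Set.univ := by
    rw [← contDiff_omega_iff_analyticOnNhd]
    exact contDiff_const.sub (((A.restrictScalars ℝ).contDiff.comp
      (hμ.contDiff_expLp hR ⟨0, hB⟩)).norm_sq ℂ)
  have hd : ∀ t, 1 - ‖A (expLp μ t)‖ ^ 2 ≤ 0 := by
    refine nonpos_of_harmonic hR hν hanalytic (fun t => ?_) (fun S hS => ⟨c ⟨S, hS⟩, hc ⟨S, hS⟩, ?_⟩)
      ⟨_, isMinimal_singleton_zero hB hl hα hν⟩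
    · simp only [mul_sub, mul_one, Finset.sum_sub_distrib, hν]
      rw [hAT]
      simp [hT.apply_exp, norm_smul, mul_pow]
    -- The empty word alone contributes |⟨e_c, e_c⟩|² = 1, which with the contraction bound forces
    -- ‖A e_c‖ = 1.
    · have h1 := (hsum (expLp μ (c ⟨S, hS⟩))).tsum_eq ▸
        (hsum (expLp μ (c ⟨S, hS⟩))).summable.le_tsum ⟨⟨S, hS⟩, [], nil_mem_Omega0 _⟩
          fun _ _ => by positivity
      simp only [hf] at h1
      rw [norm_inner_weightedExp_nil, inner_self_eq_norm_sq_to_K, norm_expLp] at h1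
      have h2 := hA (expLp μ (c ⟨S, hS⟩))
      rw [norm_expLp] at h2
      have h3 : ‖A (expLp μ (c ⟨S, hS⟩))‖ ^ 2 ≤ 1 := pow_le_one₀ (norm_nonneg _) h2
      have h4 : 1 ≤ ‖A (expLp μ (c ⟨S, hS⟩))‖ ^ 2 := by simpa using h1
      linarith
  intro v
  have hv : ‖A v‖ = ‖v‖ := by
    refine norm_eq_of_contraction A hA topologicalClosure_span_expLp ?_ v
    rintro _ ⟨t, rfl⟩
    have h1 := hd t
    have h2 := hA (expLp μ t)
    rw [norm_expLp] at h2 ⊢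
    nlinarith [norm_nonneg (A (expLp μ t))]
  rw [← hv]
  exact hsum v

end WeightedFourier

theorem corollary4p7 (R : ℤ) (hR : 1 < |R|) (B : Finset ℤ) (hB : 0 ∈ B)
    (μ : MeasureTheory.Measure ℝ) [MeasureTheory.IsProbabilityMeasure μ]
    (hμ : WeightedFourier.IsInvariantMeasure R B μ)
    (m : ℕ) [NeZero m] (l : Fin m → ℤ) (hl : l 0 = 0) (α : Fin m → ℂ) (hα : α 0 = 1)
    (hiso : (WeightedFourier.weightedMatrix R B l α).conjTranspose *
      WeightedFourier.weightedMatrix R B l α = 1)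
    (c : {S : Set ℝ // WeightedFourier.IsMinimalFiniteInvariantSet R B l α S} → ℝ)
    (hc : ∀ S, c S ∈ S.1) :
    {S : Set ℝ | WeightedFourier.IsMinimalFiniteInvariantSet R B l α S}.Finite ∧
    WeightedFourier.IsParsevalFrame
      (fun p : (S : {S : Set ℝ // WeightedFourier.IsMinimalFiniteInvariantSet R B l α S}) ×
          WeightedFourier.Omega0 R B l α (c S) =>
        WeightedFourier.weightedExp μ R l α p.2.1 (c p.1)) := by
  have hR0 : R ≠ 0 := by rintro rfl; simp at hR
  obtain ⟨T, h1, h2, h3⟩ := WeightedFourier.exists_transfer hR0 ⟨0, hB⟩ hμ hiso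
  have hT : WeightedFourier.IsTransfer R B l α T := ⟨h1, h2, h3⟩
  exact ⟨WeightedFourier.finite_minimalSets hR hB hl hα hT.sum_norm_sq_nu,
    hT.isParsevalFrame hR hB hμ hl hα c hc⟩
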